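/- Let $n \ge 2$ and $r \ge 1$ be integers, and write $\mathbb Z[1/n]=\{p/n^k : p\in\mathbb Z,\ k\in\mathbb Z_{\ge 0}\}$. Let $F_{n,r}$ be the group, under composition, of all orientation preserving piecewise linear homeomorphisms $h$ of $[0,r]$ such that all (finitely many) singularities of $h$ lie in $\mathbb Z[1/n]$ and the derivative of $h$ at every non-singular point is $n^k$ for some $k\in\mathbb Z$. Let $G_{n,r}$ be the group, under composition, of all right continuous piecewise linear bijections $h$ of $[0,r)$ with finitely many discontinuities and singularities, all in $\mathbb Z[1/n]$, such that the derivative of $h$ at every non-singular point is $n^k$ for some $k\in\mathbb Z$ and $h$ maps $\mathbb Z[1/n]\cap[0,r)$ to itself. Both groups act canonically on $[0,r]$ (elements of $G_{n,r}$ are extended by fixing the point $r$), preserving the class of the normalized Lebesgue measure $\lambda_r$ on $[0,r]$. Let $G$ be $F_{n,r}$ or $G_{n,r}$. Then the Koopman representation $\kappa$ of $G$, that is, the unitary representation in the complex Hilbert space $L^2([0,r],\lambda_r)$ given by $$(\kappa(g)f)(x)=\sqrt{\frac{\mathrm d\lambda_r(g^{-1}(x))}{\mathrm d\lambda_r(x)}}\;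 f(g^{-1}x),$$ is irreducible: the only closed $\kappa(G)$-invariant subspaces of $L^2([0,r],\lambda_r)$ are $\{0\}$ and the whole (nonzero) space. -/

import Mathlib

open MeasureTheory Set Filter Topology
open scoped ENNReal NNReal

noncomputable section

set_option linter.unusedSectionVars false

namespace Koopman

section Rep

/-- The action of `G` on `X` preserves the class of the measure `μ` (`μ` is quasi-invariant). -/
class MeasureClassPreserving (G : Type*) {X : Type*} [Group G] [MulAction G X]
    [MeasurableSpace X] (μ : Measure X) : Prop where
  quasi : ∀ g : G, Measure.QuasiMeasurePreserving (fun x : X => g • x) μ μ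

variable {G X : Type*} [Group G] [MulAction G X] [MeasurableSpace X]

/-- The Radon-Nikodym derivative `dμ(g⁻¹ x) / dμ(x)`, i.e. the density with respect to `μ` of the
measure `A ↦ μ (g⁻¹ A)`, which is the push-forward of `μ` under `g`. -/
def density (μ : Measure X) (g : G) : X → ℝ≥0∞ :=
  (μ.map (fun x : X => g • x)).rnDeriv μ

/-- `(κ(g) f)(x) = √(dμ(g⁻¹ x) / dμ(x)) f(g⁻¹ x)` -/
def koopmanFun (μ : Measure X) (g : G) (f : X → ℂ) : X → ℂ :=
  fun x => ((Real.sqrt (density μ g x).toReal : ℝ) : ℂ) * f (g⁻¹ • x)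

theorem measurable_smul (μ : Measure X) [MeasureClassPreserving G μ] (g : G) :
    Measurable (fun x : X => g • x) :=
  (MeasureClassPreserving.quasi (μ := μ) g).measurable

theorem measurable_density (μ : Measure X) (g : G) : Measurable (density μ g) :=
  Measure.measurable_rnDeriv _ _

variable (μ : Measure X) [IsProbabilityMeasure μ] [MeasureClassPreserving G μ]

theorem withDensity_density (g : G) :
    μ.withDensity (density μ g) = μ.map (fun x : X => g • x) :=
  Measure.withDensity_rnDeriv_eq _ _ (MeasureClassPreserving.quasi (μ := μ) g).absolutelyContinuous

theorem density_lt_top (g : G) : ∀ᵐ x ∂μ, density μ g x < ∞ :=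
  Measure.rnDeriv_lt_top _ _

theorem lintegral_density_mul (g : G) {F : X → ℝ≥0∞} (hF : Measurable F) :
    ∫⁻ x, density μ g x * F (g⁻¹ • x) ∂μ = ∫⁻ x, F x ∂μ := by
  have h1 : Measurable fun x : X => F (g⁻¹ • x) := hF.comp (measurable_smul μ g⁻¹)
  have := lintegral_withDensity_eq_lintegral_mul μ (measurable_density μ g) h1
  simp only [Pi.mul_apply] at this
  rw [← this, withDensity_density, lintegral_map h1 (measurable_smul μ g)]
  simp

theorem density_mul (g h : G) :
    density μ (g * h) =ᵐ[μ] fun x => density μ g x * density μ h (g⁻¹ • x) := by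
  have hm : Measurable fun x : X => density μ h (g⁻¹ • x) :=
    (measurable_density μ h).comp (measurable_smul μ g⁻¹)
  have key : μ.withDensity (density μ (g * h)) =
      μ.withDensity (fun x => density μ g x * density μ h (g⁻¹ • x)) := by
    ext A hA
    rw [withDensity_density, Measure.map_apply (measurable_smul μ (g * h)) hA, withDensity_apply _ hA,
      ← lintegral_indicator hA]
    have hF : Measurable fun y : X => ((fun y => g • y) ⁻¹' A).indicator (density μ h) y :=
      (measurable_density μ h).indicator (measurable_smul μ g hA)
    have e : ∀ x, A.indicator (fun x => density μ g x * density μ h (g⁻¹ • x)) x =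
        density μ g x * ((fun y => g • y) ⁻¹' A).indicator (density μ h) (g⁻¹ • x) := by
      intro x
      by_cases hx : x ∈ A <;> simp [hx]
    simp_rw [e]
    rw [lintegral_density_mul μ g hF, lintegral_indicator (measurable_smul μ g hA),
      ← withDensity_apply _ (measurable_smul μ g hA), withDensity_density,
      Measure.map_apply (measurable_smul μ h) (measurable_smul μ g hA)]
    congr 1
    ext x
    simp [mul_smul]
  refine (withDensity_eq_iff_of_sigmaFinite (measurable_density μ _).aemeasurable
    ((measurable_density μ g).mul hm).aemeasurable).1 key

theorem density_one : density μ (1 : G) =ᵐ[μ] fun _ => 1 := by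
  have : (μ.map (fun x : X => (1 : G) • x)) = μ := by simp
  unfold density
  rw [this]
  exact Measure.rnDeriv_self μ

theorem koopmanFun_congr (g : G) {f f' : X → ℂ} (h : f =ᵐ[μ] f') :
    koopmanFun μ g f =ᵐ[μ] koopmanFun μ g f' := by
  filter_upwards [(MeasureClassPreserving.quasi (μ := μ) g⁻¹).ae_eq h] with x hx
  simp only [Function.comp] at hx
  simp [koopmanFun, hx]

theorem aestronglyMeasurable_koopmanFun (g : G) {f : X → ℂ} (hf : AEStronglyMeasurable f μ) :
    AEStronglyMeasurable (koopmanFun μ g f) μ := by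
  refine AEStronglyMeasurable.mul ?_
    (hf.comp_quasiMeasurePreserving (MeasureClassPreserving.quasi (μ := μ) g⁻¹))
  exact (Complex.measurable_ofReal.comp
    ((measurable_density μ g).ennreal_toReal.sqrt)).aestronglyMeasurable

theorem eLpNorm_koopmanFun (g : G) {f : X → ℂ} (hf : AEStronglyMeasurable f μ) :
    eLpNorm (koopmanFun μ g f) 2 μ = eLpNorm f 2 μ := by
  rw [eLpNorm_congr_ae (koopmanFun_congr μ g hf.ae_eq_mk), eLpNorm_congr_ae hf.ae_eq_mk]
  have hm := hf.stronglyMeasurable_mk.measurable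
  set f' := hf.mk f
  rw [eLpNorm_eq_lintegral_rpow_enorm_toReal (by simp) (by simp),
    eLpNorm_eq_lintegral_rpow_enorm_toReal (by simp) (by simp)]
  congr 1
  have hF : Measurable fun x => ‖f' x‖ₑ ^ (2 : ℝ≥0∞).toReal := by fun_prop
  rw [← lintegral_density_mul μ g hF]
  refine lintegral_congr_ae ?_
  filter_upwards [density_lt_top μ g] with x hx
  simp only [koopmanFun, enorm_mul, ENNReal.toReal_ofNat]
  rw [ENNReal.mul_rpow_of_nonneg _ _ (by norm_num)]
  congr 1
  rw [← ofReal_norm, Complex.norm_real, Real.norm_of_nonneg (Real.sqrt_nonneg _),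
    ENNReal.ofReal_rpow_of_nonneg (Real.sqrt_nonneg _) (by norm_num), Real.rpow_ofNat,
    Real.sq_sqrt ENNReal.toReal_nonneg, ENNReal.ofReal_toReal hx.ne]

theorem memLp_koopmanFun (g : G) {f : X → ℂ} (hf : MemLp f 2 μ) :
    MemLp (koopmanFun μ g f) 2 μ :=
  ⟨aestronglyMeasurable_koopmanFun μ g hf.1, by
    rw [eLpNorm_koopmanFun μ g hf.1]; exact hf.2⟩

theorem koopmanFun_mul (g h : G) (f : X → ℂ) :
    koopmanFun μ (g * h) f =ᵐ[μ] koopmanFun μ g (koopmanFun μ h f) := by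
  filter_upwards [density_mul μ g h] with x hx
  simp only [koopmanFun, hx, ENNReal.toReal_mul, Real.sqrt_mul ENNReal.toReal_nonneg, mul_inv_rev,
    mul_smul, Complex.ofReal_mul, mul_assoc]

theorem koopmanFun_one (f : X → ℂ) : koopmanFun μ (1 : G) f =ᵐ[μ] f := by
  filter_upwards [density_one (G := G) μ] with x hx
  simp [koopmanFun, hx]

/-- The operator `κ(g)` on the Hilbert space `L²(X, μ)` of complex functions. -/
def koopmanIsometry (g : G) : Lp ℂ 2 μ →ₗᵢ[ℂ] Lp ℂ 2 μ where
  toFun f := (memLp_koopmanFun μ g (Lp.memLp f)).toLp _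
  map_add' f f' := by
    rw [← MemLp.toLp_add, MemLp.toLp_eq_toLp_iff]
    refine (koopmanFun_congr μ g (Lp.coeFn_add f f')).trans (Eventually.of_forall fun x => ?_)
    simp [koopmanFun, mul_add]
  map_smul' c f := by
    rw [RingHom.id_apply, ← MemLp.toLp_const_smul, MemLp.toLp_eq_toLp_iff]
    refine (koopmanFun_congr μ g (Lp.coeFn_smul c f)).trans (Eventually.of_forall fun x => ?_)
    simp [koopmanFun, mul_left_comm]
  norm_map' f := by
    simp only [LinearMap.coe_mk, AddHom.coe_mk]
    rw [Lp.norm_toLp, eLpNorm_koopmanFun μ g (Lp.memLp f).1, Lp.norm_def]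

theorem koopmanIsometry_coeFn (g : G) (f : Lp ℂ 2 μ) :
    koopmanIsometry μ g f =ᵐ[μ] koopmanFun μ g f :=
  MemLp.coeFn_toLp (memLp_koopmanFun μ g (Lp.memLp f))

theorem koopmanIsometry_mul (g h : G) (f : Lp ℂ 2 μ) :
    koopmanIsometry μ (g * h) f = koopmanIsometry μ g (koopmanIsometry μ h f) := by
  apply Lp.ext
  refine (koopmanIsometry_coeFn μ _ _).trans ((koopmanFun_mul μ g h _).trans ?_)
  exact (koopmanFun_congr μ g (koopmanIsometry_coeFn μ h f).symm).trans
    (koopmanIsometry_coeFn μ g _).symm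

theorem koopmanIsometry_one (f : Lp ℂ 2 μ) : koopmanIsometry μ (1 : G) f = f := by
  apply Lp.ext
  exact (koopmanIsometry_coeFn μ _ _).trans (koopmanFun_one μ _)

/-- `κ(g)` as a surjective isometry of `L²(X, μ)`, with inverse `κ(g⁻¹)`. -/
def koopmanEquiv (g : G) : Lp ℂ 2 μ ≃ₗᵢ[ℂ] Lp ℂ 2 μ where
  toLinearEquiv := LinearEquiv.ofLinearMap (koopmanIsometry μ g).toLinearMap
    (koopmanIsometry μ g⁻¹).toLinearMap
    (by
      ext1 f
      simp only [LinearMap.comp_apply, LinearIsometry.coe_toLinearMap, LinearMap.id_apply]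
      rw [← koopmanIsometry_mul, mul_inv_cancel, koopmanIsometry_one])
    (by
      ext1 f
      simp only [LinearMap.comp_apply, LinearIsometry.coe_toLinearMap, LinearMap.id_apply]
      rw [← koopmanIsometry_mul, inv_mul_cancel, koopmanIsometry_one])
  norm_map' f := (koopmanIsometry μ g).norm_map f

variable (G) in
/-- The Koopman representation of `G` in `L²(X, μ)`, as a unitary representation. -/
def koopman : G →* unitary (Lp ℂ 2 μ →L[ℂ] Lp ℂ 2 μ) where
  toFun g := Unitary.linearIsometryEquiv.symm (koopmanEquiv μ g)
  map_one' := by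
    rw [← map_one Unitary.linearIsometryEquiv.symm]
    congr 1
    ext1 f
    exact koopmanIsometry_one μ f
  map_mul' g h := by
    rw [← map_mul]
    congr 1
    ext1 f
    exact koopmanIsometry_mul μ g h f

theorem koopman_apply (g : G) (f : Lp ℂ 2 μ) :
    (koopman G μ g : Lp ℂ 2 μ →L[ℂ] Lp ℂ 2 μ) f =ᵐ[μ] koopmanFun μ g f :=
  koopmanIsometry_coeFn μ g f

end Rep

/-- A unitary representation in a Hilbert space `H` is irreducible if `H ≠ 0` and the only closed
invariant subspaces are `0` and `H`. -/
def IsIrreducibleRep {G H : Type*} [Group G] [NormedAddCommGroup H] [InnerProductSpace ℂ H]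
    [CompleteSpace H] (π : G →* unitary (H →L[ℂ] H)) : Prop :=
  Nontrivial H ∧ ∀ V : Submodule ℂ H, IsClosed (V : Set H) →
    (∀ g : G, ∀ v ∈ V, (π g : H →L[ℂ] H) v ∈ V) → V = ⊥ ∨ V = ⊤

end Koopman

namespace HigmanThompson

/-- `ℤ[1/n]` as a subset of `ℝ`. -/
def nAdic (n : ℕ) : Set ℝ := {x | ∃ (p : ℤ) (k : ℕ), x = (p : ℝ) / (n : ℝ) ^ k}

/-- Near the point `x` of `D ⊆ ℝ`, the self-map `h` of `D` is affine with slope a power of `n`. -/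
def IsAffineNear (n : ℕ) {D : Set ℝ} (h : D → D) (x : D) : Prop :=
  ∃ (k : ℤ) (c : ℝ), ∀ᶠ y : D in 𝓝 x, (h y : ℝ) = (n : ℝ) ^ k * (y : ℝ) + c

/-- `h` is piecewise linear with finitely many singularities, all of them in `ℤ[1/n]`, and near
every other point it is affine with slope an integral power of `n`. -/
structure IsPiecewiseLinear (n : ℕ) {D : Set ℝ} (h : D → D) : Prop where
  finite : {x : D | ¬ IsAffineNear n h x}.Finite
  mem_nAdic : ∀ x : D, ¬ IsAffineNear n h x → (x : ℝ) ∈ nAdic n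

section Aux

variable {n : ℕ} [NeZero n]

theorem base_pos : (0 : ℝ) < n := by exact_mod_cast Nat.pos_of_ne_zero (NeZero.ne n)

theorem zero_mem_nAdic : (0 : ℝ) ∈ nAdic n := ⟨0, 0, by simp⟩

theorem natCast_mem_nAdic (m : ℕ) : (m : ℝ) ∈ nAdic n := ⟨m, 0, by simp⟩

theorem add_mem_nAdic {x y : ℝ} (hx : x ∈ nAdic n) (hy : y ∈ nAdic n) : x + y ∈ nAdic n := by
  obtain ⟨p, k, rfl⟩ := hx
  obtain ⟨q, l, rfl⟩ := hy
  refine ⟨p * n ^ l + q * n ^ k, k + l, ?_⟩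
  have := (base_pos (n := n)).ne'
  push_cast
  field_simp
  ring

theorem sub_mem_nAdic {x y : ℝ} (hx : x ∈ nAdic n) (hy : y ∈ nAdic n) : x - y ∈ nAdic n := by
  obtain ⟨q, l, rfl⟩ := hy
  have : -((q : ℝ) / (n : ℝ) ^ l) ∈ nAdic n := ⟨-q, l, by push_cast; ring⟩
  simpa [sub_eq_add_neg] using add_mem_nAdic hx this

theorem zpow_mul_mem_nAdic (k : ℤ) {x : ℝ} (hx : x ∈ nAdic n) : (n : ℝ) ^ k * x ∈ nAdic n := by
  obtain ⟨p, l, rfl⟩ := hx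
  have := (base_pos (n := n)).ne'
  obtain ⟨m, rfl | rfl⟩ := k.eq_nat_or_neg
  · exact ⟨n ^ m * p, l, by push_cast; rw [zpow_natCast]; ring⟩
  · refine ⟨p, l + m, ?_⟩
    rw [zpow_neg, zpow_natCast]
    field_simp
    ring

theorem affine_of_local {f : ℝ → ℝ} {a b : ℝ} (hab : a < b)
    (H : ∀ x ∈ Ioo a b, ∃ (k : ℤ) (c : ℝ), ∀ᶠ y in 𝓝 x, f y = (n : ℝ) ^ k * y + c) :
    ∃ (k : ℤ) (c : ℝ), ∀ x ∈ Ioo a b, f x = (n : ℝ) ^ k * x + c := by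
  have hd : ∀ x ∈ Ioo a b, ∃ k : ℤ, deriv f =ᶠ[𝓝 x] fun _ => (n : ℝ) ^ k := by
    intro x hx
    obtain ⟨k, c, hk⟩ := H x hx
    refine ⟨k, ?_⟩
    filter_upwards [hk.eventually_nhds] with y hy
    have : HasDerivAt (fun y : ℝ => (n : ℝ) ^ k * y + c) ((n : ℝ) ^ k) y := by
      simpa using ((hasDerivAt_id y).const_mul ((n : ℝ) ^ k)).add_const c
    exact (this.congr_of_eventuallyEq hy).deriv
  have hdiff : DifferentiableOn ℝ f (Ioo a b) := by
    intro x hx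
    obtain ⟨k, c, hk⟩ := H x hx
    have : DifferentiableAt ℝ (fun y : ℝ => (n : ℝ) ^ k * y + c) x := by fun_prop
    exact (this.congr_of_eventuallyEq hk).differentiableWithinAt
  obtain ⟨x₀, hx₀⟩ := nonempty_Ioo.2 hab
  obtain ⟨k, hk⟩ := hd x₀ hx₀
  have hconst : ∀ x ∈ Ioo a b, deriv f x = (n : ℝ) ^ k := by
    intro x hx
    rw [← hk.eq_of_nhds]
    refine isOpen_Ioo.is_const_of_deriv_eq_zero (𝕜 := ℝ) isPreconnected_Ioo ?_ ?_ hx hx₀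
    · intro y hy
      obtain ⟨l, hl⟩ := hd y hy
      exact ((differentiableAt_const ((n : ℝ) ^ l)).congr_of_eventuallyEq hl).differentiableWithinAt
    · intro y hy
      obtain ⟨l, hl⟩ := hd y hy
      rw [hl.deriv_eq]
      simp
  refine ⟨k, f x₀ - (n : ℝ) ^ k * x₀, fun x hx => ?_⟩
  have : (fun y => f y - (n : ℝ) ^ k * y) x = (fun y => f y - (n : ℝ) ^ k * y) x₀ := by
    refine isOpen_Ioo.is_const_of_deriv_eq_zero (f := fun y => f y - (n : ℝ) ^ k * y)
      isPreconnected_Ioo ?_ ?_ hx hx₀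
    · exact hdiff.sub (by fun_prop)
    · intro y hy
      have h1 := (hdiff.differentiableAt (isOpen_Ioo.mem_nhds hy)).hasDerivAt
      rw [hconst y hy] at h1
      have h2 := h1.sub ((hasDerivAt_id y).const_mul ((n : ℝ) ^ k))
      exact (h2.congr_deriv (by simp)).deriv
  simp only at this
  linarith

variable {D : Set ℝ}

theorem IsAffineNear.continuousAt {h : D → D} {x : D} (H : IsAffineNear n h x) :
    ContinuousAt h x := by
  obtain ⟨k, c, hk⟩ := H
  refine tendsto_subtype_rng.2 ?_
  have hcont : Continuous fun y : D => (n : ℝ) ^ k * (y : ℝ) + c := by fun_prop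
  have := hcont.tendsto x
  rw [← hk.self_of_nhds] at this
  exact this.congr' (hk.mono fun y hy => hy.symm)

theorem IsAffineNear.comp {g h : D → D} {x : D} (hg : IsAffineNear n g (h x))
    (hh : IsAffineNear n h x) : IsAffineNear n (g ∘ h) x := by
  have hc := hh.continuousAt
  obtain ⟨k, c, hk⟩ := hh
  obtain ⟨l, d, hl⟩ := hg
  refine ⟨l + k, (n : ℝ) ^ l * c + d, ?_⟩
  filter_upwards [hk, hc.eventually hl] with y h1 h2
  rw [Function.comp, h2, h1, zpow_add₀ (base_pos (n := n)).ne']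
  ring

theorem gap {h : D → D} (a : D) {b : ℝ} (hab : (a : ℝ) < b) (hD : Ico (a : ℝ) b ⊆ D)
    (H : ∀ x : D, a < x → (x : ℝ) < b → IsAffineNear n h x)
    (hc : ContinuousWithinAt h (Ici a) a) :
    ∃ k : ℤ, ∀ y : D, a ≤ y → (y : ℝ) < b →
      (h y : ℝ) = (h a : ℝ) + (n : ℝ) ^ k * ((y : ℝ) - a) := by
  classical
  let f : ℝ → ℝ := fun y => if hy : y ∈ D then (h ⟨y, hy⟩ : ℝ) else 0
  have hf : ∀ y : D, f y = h y := fun y => by simp [f]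
  obtain ⟨k, c, hkc⟩ : ∃ (k : ℤ) (c : ℝ), ∀ x ∈ Ioo (a : ℝ) b, f x = (n : ℝ) ^ k * x + c := by
    refine affine_of_local hab fun x hx => ?_
    have hxD : x ∈ D := hD ⟨hx.1.le, hx.2⟩
    obtain ⟨k, c, hk⟩ := H ⟨x, hxD⟩ hx.1 hx.2
    refine ⟨k, c, ?_⟩
    rw [nhds_subtype_eq_comap, Filter.eventually_comap] at hk
    filter_upwards [hk, isOpen_Ioo.mem_nhds hx] with y hy hy'
    have hyD : y ∈ D := hD ⟨hy'.1.le, hy'.2⟩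
    exact (hf ⟨y, hyD⟩).trans (hy ⟨y, hyD⟩ rfl)
  have hlim : Tendsto (fun m : ℕ => (a : ℝ) + (b - a) / ((m : ℝ) + 2)) atTop (𝓝 a) := by
    have : Tendsto (fun m : ℕ => (b - a) / ((m : ℝ) + 2)) atTop (𝓝 0) :=
      tendsto_const_nhds.div_atTop
        (tendsto_atTop_add_const_right _ _ tendsto_natCast_atTop_atTop)
    simpa using tendsto_const_nhds.add this
  have hmem : ∀ m : ℕ, (a : ℝ) + (b - a) / ((m : ℝ) + 2) ∈ Ioo (a : ℝ) b := by
    intro m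
    have h0 : 0 < b - a := sub_pos.2 hab
    have h1 : 0 < (b - a) / ((m : ℝ) + 2) := by positivity
    have h2 : (b - a) / ((m : ℝ) + 2) < b - a := div_lt_self h0 (by linarith [m.cast_nonneg (α := ℝ)])
    constructor <;> linarith
  let u : ℕ → D := fun m => ⟨_, hD ⟨(hmem m).1.le, (hmem m).2⟩⟩
  have hu : Tendsto u atTop (𝓝[Ici a] a) := by
    refine tendsto_nhdsWithin_iff.2 ⟨?_, Eventually.of_forall fun m => ?_⟩
    · exact tendsto_subtype_rng.2 hlim
    · exact (hmem m).1.le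
  have h1 : Tendsto (fun m => (h (u m) : ℝ)) atTop (𝓝 (h a : ℝ)) :=
    (continuous_subtype_val.tendsto _).comp (hc.tendsto.comp hu)
  have h2 : Tendsto (fun m => (h (u m) : ℝ)) atTop (𝓝 ((n : ℝ) ^ k * a + c)) := by
    have : (fun m => (h (u m) : ℝ)) = fun m => (n : ℝ) ^ k * (u m : ℝ) + c := by
      funext m
      rw [← hf]; exact hkc _ (hmem m)
    rw [this]
    exact (hlim.const_mul _).add_const _
  have h3 := tendsto_nhds_unique h1 h2
  refine ⟨k, fun y hy hyb => ?_⟩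
  rcases hy.eq_or_lt with rfl | hlt
  · simp
  · rw [← hf, hkc y ⟨hlt, hyb⟩, h3]; ring

theorem leftStep {h : D → D} (hD : D.OrdConnected) (o : D) (ho : (o : ℝ) = 0)
    (hP : IsPiecewiseLinear n h)
    (hr : ∀ x, ContinuousWithinAt h (Ici x) x) (x : D) (hx : o < x)
    (hl : ContinuousWithinAt h (Iic x) x) :
    ∃ s : D, s < x ∧ (s = o ∨ ¬ IsAffineNear n h s) ∧ (s : ℝ) ∈ nAdic n ∧
      ∃ k : ℤ, (h x : ℝ) = (h s : ℝ) + (n : ℝ) ^ k * ((x : ℝ) - s) := by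
  have hfin : ({z : D | ¬ IsAffineNear n h z ∧ z < x} ∪ {o}).Finite :=
    (hP.finite.subset fun z hz => hz.1).union (finite_singleton o)
  obtain ⟨s, hs, hmax⟩ := Set.exists_max_image _ id hfin ⟨o, Or.inr rfl⟩
  have hsx : s < x := by
    rcases hs with hs | hs
    · exact hs.2
    · rw [mem_singleton_iff.1 hs]; exact hx
  have hs' : s = o ∨ ¬ IsAffineNear n h s := by
    rcases hs with hs | hs
    · exact Or.inr hs.1
    · exact Or.inl hs
  have hsub : Icc (s : ℝ) x ⊆ D := hD.out s.2 x.2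
  have hsx' : (s : ℝ) < x := hsx
  obtain ⟨k, hk⟩ := gap (n := n) s hsx' (fun y hy => hsub ⟨hy.1, hy.2.le⟩)
    (fun y hy1 hy2 => by
      by_contra hcon
      exact absurd (hmax y (Or.inl ⟨hcon, hy2⟩)) (not_le.2 hy1)) (hr s)
  refine ⟨s, hsx, hs', ?_, k, ?_⟩
  · rcases hs' with rfl | hs'
    · rw [ho]; exact zero_mem_nAdic
    · exact hP.mem_nAdic _ hs'
  have hlim : Tendsto (fun m : ℕ => (x : ℝ) - ((x : ℝ) - s) / ((m : ℝ) + 2)) atTop (𝓝 x) := by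
    have : Tendsto (fun m : ℕ => ((x : ℝ) - s) / ((m : ℝ) + 2)) atTop (𝓝 0) :=
      tendsto_const_nhds.div_atTop
        (tendsto_atTop_add_const_right _ _ tendsto_natCast_atTop_atTop)
    simpa using tendsto_const_nhds.sub this
  have hmem : ∀ m : ℕ, (x : ℝ) - ((x : ℝ) - s) / ((m : ℝ) + 2) ∈ Ioo (s : ℝ) x := by
    intro m
    have h0 : 0 < (x : ℝ) - s := sub_pos.2 hsx'
    have h1 : 0 < ((x : ℝ) - s) / ((m : ℝ) + 2) := by positivity
    have h2 : ((x : ℝ) - s) / ((m : ℝ) + 2) < (x : ℝ) - s :=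
      div_lt_self h0 (by linarith [m.cast_nonneg (α := ℝ)])
    constructor <;> linarith
  let u : ℕ → D := fun m => ⟨_, hsub ⟨(hmem m).1.le, (hmem m).2.le⟩⟩
  have hu : Tendsto u atTop (𝓝[Iic x] x) := by
    refine tendsto_nhdsWithin_iff.2 ⟨?_, Eventually.of_forall fun m => ?_⟩
    · exact tendsto_subtype_rng.2 hlim
    · exact (hmem m).2.le
  have h1 : Tendsto (fun m => (h (u m) : ℝ)) atTop (𝓝 (h x : ℝ)) :=
    (continuous_subtype_val.tendsto _).comp (hl.tendsto.comp hu)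
  have h2 : Tendsto (fun m => (h (u m) : ℝ)) atTop
      (𝓝 ((h s : ℝ) + (n : ℝ) ^ k * ((x : ℝ) - s))) := by
    have : (fun m => (h (u m) : ℝ)) = fun m => (h s : ℝ) + (n : ℝ) ^ k * ((u m : ℝ) - s) := by
      funext m
      exact hk (u m) (hmem m).1.le (hmem m).2
    rw [this]
    exact ((hlim.sub_const _).const_mul _).const_add _
  exact tendsto_nhds_unique h1 h2

theorem mem_nAdic_of_apply {h : D → D} (hD : D.OrdConnected) (o : D) (ho : (o : ℝ) = 0)
    (hmin : ∀ x : D, o ≤ x) (hP : IsPiecewiseLinear n h)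
    (hr : ∀ x, ContinuousWithinAt h (Ici x) x)
    (hmap : ∀ x : D, (x : ℝ) ∈ nAdic n → (h x : ℝ) ∈ nAdic n)
    (x : D) (hx : (h x : ℝ) ∈ nAdic n) : (x : ℝ) ∈ nAdic n := by
  by_cases hA : IsAffineNear n h x
  · rcases (hmin x).eq_or_lt with rfl | hlt
    · rw [ho]; exact zero_mem_nAdic
    obtain ⟨s, -, -, hs, k, hk⟩ := leftStep hD o ho hP hr x hlt hA.continuousAt.continuousWithinAt
    have : (x : ℝ) = s + (n : ℝ) ^ (-k) * ((h x : ℝ) - h s) := by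
      rw [hk, zpow_neg]
      have := (zpow_pos (base_pos (n := n)) k).ne'
      field_simp
      ring
    rw [this]
    exact add_mem_nAdic hs (zpow_mul_mem_nAdic _ (sub_mem_nAdic hx (hmap s hs)))
  · exact hP.mem_nAdic x hA

theorem apply_mem_nAdic {h : D → D} (hD : D.OrdConnected) (o : D) (ho : (o : ℝ) = 0)
    (hmin : ∀ x : D, o ≤ x) (hP : IsPiecewiseLinear n h) (hc : Continuous h) (h0 : h o = o)
    (x : D) (hx : (x : ℝ) ∈ nAdic n) : (h x : ℝ) ∈ nAdic n := by
  have key : ∀ x : D, (x : ℝ) ∈ nAdic n → (h x : ℝ) ∉ nAdic n →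
      ∃ s : D, s < x ∧ ¬ IsAffineNear n h s ∧ (h s : ℝ) ∉ nAdic n := by
    intro x hx hbad
    have hox : o < x := by
      refine lt_of_le_of_ne (hmin x) ?_
      rintro rfl
      exact hbad (by rw [h0]; exact hx)
    obtain ⟨s, hsx, hs, hsn, k, hk⟩ := leftStep hD o ho hP
      (fun x => hc.continuousWithinAt) x hox hc.continuousWithinAt
    have hsb : (h s : ℝ) ∉ nAdic n := fun hcon => hbad (by
      rw [hk]; exact add_mem_nAdic hcon (zpow_mul_mem_nAdic _ (sub_mem_nAdic hx hsn)))
    refine ⟨s, hsx, hs.resolve_left ?_, hsb⟩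
    rintro rfl
    exact hsb (by rw [h0]; exact hsn)
  by_contra hbad
  obtain ⟨s, -, hs, hsb⟩ := key x hx hbad
  obtain ⟨t, ⟨ht, htb⟩, hmin'⟩ := Set.exists_min_image
    {z : D | ¬ IsAffineNear n h z ∧ (h z : ℝ) ∉ nAdic n} id
    (hP.finite.subset fun z hz => hz.1) ⟨s, hs, hsb⟩
  obtain ⟨w, hwt, hw, hwb⟩ := key t (hP.mem_nAdic t ht) htb
  exact absurd (hmin' w ⟨hw, hwb⟩) (not_le.2 hwt)

theorem IsPiecewiseLinear.id : IsPiecewiseLinear n (id : D → D) := by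
  have : ∀ x : D, IsAffineNear n (_root_.id : D → D) x :=
    fun x => ⟨0, 0, Eventually.of_forall fun y => by simp⟩
  exact ⟨by simp [this], fun x hx => absurd (this x) hx⟩

theorem IsPiecewiseLinear.comp {g h : D → D} (hg : IsPiecewiseLinear n g)
    (hh : IsPiecewiseLinear n h) (hinj : Function.Injective h)
    (hback : ∀ x : D, (h x : ℝ) ∈ nAdic n → (x : ℝ) ∈ nAdic n) :
    IsPiecewiseLinear n (g ∘ h) := by
  have key : ∀ x, ¬ IsAffineNear n (g ∘ h) x → ¬ IsAffineNear n h x ∨ ¬ IsAffineNear n g (h x) := by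
    intro x hx
    by_contra! hcon
    exact hx (hcon.2.comp hcon.1)
  constructor
  · exact (hh.finite.union (hg.finite.preimage hinj.injOn)).subset fun x hx => key x hx
  · intro x hx
    rcases key x hx with h1 | h1
    · exact hh.mem_nAdic x h1
    · exact hback x (hg.mem_nAdic _ h1)

theorem IsPiecewiseLinear.symm {e : Equiv.Perm D} (he : IsPiecewiseLinear n e) (o : D)
    (ho : (o : ℝ) = 0) (hmap : ∀ x : D, (x : ℝ) ∈ nAdic n → (e x : ℝ) ∈ nAdic n)
    (key : ∀ x, x ≠ o → IsAffineNear n e x → IsAffineNear n e.symm (e x)) :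
    IsPiecewiseLinear n e.symm := by
  have key' : ∀ y, ¬ IsAffineNear n e.symm y → e.symm y = o ∨ ¬ IsAffineNear n e (e.symm y) := by
    intro y hy
    by_contra! hcon
    have := key _ hcon.1 hcon.2
    rw [Equiv.apply_symm_apply] at this
    exact hy this
  constructor
  · refine (((finite_singleton o).union he.finite).preimage e.symm.injective.injOn).subset
      fun y hy => key' y hy
  · intro y hy
    rw [← e.apply_symm_apply y]
    apply hmap
    rcases key' y hy with h1 | h1
    · rw [h1, ho]; exact zero_mem_nAdic
    · exact he.mem_nAdic _ h1

theorem affineNear_symm_of_continuous {e : Equiv.Perm D} (hc : Continuous e.symm) {x : D}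
    (H : IsAffineNear n e x) : IsAffineNear n e.symm (e x) := by
  obtain ⟨k, c, hk⟩ := H
  refine ⟨-k, -((n : ℝ) ^ (-k) * c), ?_⟩
  have : Tendsto e.symm (𝓝 (e x)) (𝓝 x) := by
    simpa using hc.tendsto (e x)
  filter_upwards [this.eventually hk] with y hy
  rw [Equiv.apply_symm_apply] at hy
  rw [hy, zpow_neg]
  have := (zpow_pos (base_pos (n := n)) k).ne'
  field_simp
  ring

theorem affineNear_symm_of_interior {e : Equiv.Perm D} {x : D} (hx : D ∈ 𝓝 (x : ℝ))
    (H : IsAffineNear n e x) : IsAffineNear n e.symm (e x) := by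
  obtain ⟨k, c, hk⟩ := H
  have hpos := (zpow_pos (base_pos (n := n)) k).ne'
  refine ⟨-k, -((n : ℝ) ^ (-k) * c), ?_⟩
  have hex := hk.self_of_nhds
  rw [nhds_subtype_eq_comap, Filter.eventually_comap] at hk
  have hback : Tendsto (fun y : D => (n : ℝ) ^ (-k) * (y : ℝ) + -((n : ℝ) ^ (-k) * c))
      (𝓝 (e x)) (𝓝 (x : ℝ)) := by
    have hcont : Continuous fun y : D => (n : ℝ) ^ (-k) * (y : ℝ) + -((n : ℝ) ^ (-k) * c) := by
      fun_prop
    have := hcont.tendsto (e x)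
    convert this using 2
    rw [hex, zpow_neg]
    field_simp
    ring
  filter_upwards [hback.eventually hk, hback.eventually hx] with y h1 h2
  have h3 := h1 ⟨_, h2⟩ rfl
  have h4 : e ⟨_, h2⟩ = y := by
    apply Subtype.ext
    rw [h3]
    simp only [zpow_neg]
    field_simp
    ring
  rw [← h4, Equiv.symm_apply_apply, h4]

end Aux

section GroupF

variable (n r : ℕ) [NeZero n]

theorem homeo_zero {r : ℕ} {h : Icc (0 : ℝ) r ≃ₜ Icc (0 : ℝ) r} (hm : StrictMono h) :
    h ⟨0, by simp⟩ = ⟨0, by simp⟩ := by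
  apply le_antisymm
  · have h1 : (⟨0, by simp⟩ : Icc (0 : ℝ) r) ≤ h.symm ⟨0, by simp⟩ := (h.symm ⟨0, by simp⟩).2.1
    simpa using hm.monotone h1
  · exact (h ⟨0, by simp⟩).2.1

theorem homeo_maps {n r : ℕ} [NeZero n] {h : Icc (0 : ℝ) r ≃ₜ Icc (0 : ℝ) r} (hm : StrictMono h)
    (hP : IsPiecewiseLinear n h) (x : Icc (0 : ℝ) r) (hx : (x : ℝ) ∈ nAdic n) :
    (h x : ℝ) ∈ nAdic n :=
  apply_mem_nAdic ordConnected_Icc (⟨0, by simp⟩ : Icc (0 : ℝ) r) rfl (fun x => x.2.1) hP h.continuous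
    (homeo_zero hm) x hx

/-- The Higman–Thompson group `F_{n,r}`: orientation preserving piecewise linear homeomorphisms
of `[0,r]` with all singularities in `ℤ[1/n]` and all slopes integral powers of `n`. The group law
is composition. -/
def groupF : Subgroup (Icc (0 : ℝ) r ≃ₜ Icc (0 : ℝ) r) where
  carrier := {h | StrictMono h ∧ IsPiecewiseLinear n h}
  one_mem' := ⟨strictMono_id, IsPiecewiseLinear.id⟩
  mul_mem' := by
    rintro g h ⟨hg, hg'⟩ ⟨hh, hh'⟩
    exact ⟨hg.comp hh, hg'.comp hh' h.injective
      (mem_nAdic_of_apply ordConnected_Icc ⟨0, by simp⟩ rfl (fun x => x.2.1) hh'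
        (fun x => h.continuous.continuousWithinAt) (homeo_maps hh hh'))⟩
  inv_mem' := by
    rintro h ⟨hh, hh'⟩
    refine ⟨fun x y hxy => ?_, ?_⟩
    · by_contra! hcon
      have := hh.monotone hcon
      change h (h.symm y) ≤ h (h.symm x) at this
      rw [Homeomorph.apply_symm_apply, Homeomorph.apply_symm_apply] at this
      exact absurd hxy (not_lt.2 this)
    · exact IsPiecewiseLinear.symm (e := h.toEquiv) hh' ⟨0, by simp⟩ rfl (homeo_maps hh hh')
        fun x _ hx => affineNear_symm_of_continuous h.symm.continuous hx

/-- The canonical action of `F_{n,r}` on `[0,r]`. -/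
instance : MulAction (groupF n r) (Icc (0 : ℝ) r) where
  smul g x := g.1 x
  one_smul _ := rfl
  mul_smul _ _ _ := rfl

end GroupF

section GroupG

theorem right_piece {n r : ℕ} [NeZero n] {h : Ico (0 : ℝ) r → Ico (0 : ℝ) r}
    (hc : ∀ x, ContinuousWithinAt h (Ici x) x) (hP : IsPiecewiseLinear n h) (x : Ico (0 : ℝ) r) :
    ∃ b : ℝ, (x : ℝ) < b ∧ b ≤ r ∧ ∃ k : ℤ, ∀ y : Ico (0 : ℝ) r, x ≤ y → (y : ℝ) < b →
      (h y : ℝ) = (h x : ℝ) + (n : ℝ) ^ k * ((y : ℝ) - x) := by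
  have hfin : ((fun z : Ico (0 : ℝ) r => (z : ℝ)) '' {z | ¬ IsAffineNear n h z ∧ x < z} ∪
      {(r : ℝ)}).Finite :=
    ((hP.finite.subset fun z hz => hz.1).image _).union (finite_singleton _)
  obtain ⟨b, hb, hmin⟩ := Set.exists_min_image _ id hfin ⟨_, Or.inr rfl⟩
  have hbr : b ≤ r := hmin r (Or.inr rfl)
  have hxb : (x : ℝ) < b := by
    rcases hb with ⟨z, hz, rfl⟩ | hb
    · exact hz.2
    · rw [mem_singleton_iff.1 hb]; exact x.2.2
  refine ⟨b, hxb, hbr, gap x hxb (fun y hy => ⟨x.2.1.trans hy.1, hy.2.trans_le hbr⟩) ?_ (hc x)⟩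
  intro y hy1 hy2
  by_contra hcon
  exact absurd (hmin y (Or.inl ⟨y, ⟨hcon, hy1⟩, rfl⟩)) (not_le.2 hy2)

theorem rightCont_comp {n r : ℕ} [NeZero n] {g h : Ico (0 : ℝ) r → Ico (0 : ℝ) r}
    (hg : ∀ x, ContinuousWithinAt g (Ici x) x)
    (hc : ∀ x, ContinuousWithinAt h (Ici x) x) (hP : IsPiecewiseLinear n h) (x : Ico (0 : ℝ) r) :
    ContinuousWithinAt (g ∘ h) (Ici x) x := by
  obtain ⟨b, hxb, -, k, hk⟩ := right_piece hc hP x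
  have ht : Tendsto h (𝓝[Ici x] x) (𝓝[Ici (h x)] (h x)) := by
    refine tendsto_nhdsWithin_iff.2 ⟨hc x, ?_⟩
    have hb : ∀ᶠ y : Ico (0 : ℝ) r in 𝓝[Ici x] x, (y : ℝ) < b :=
      nhdsWithin_le_nhds (continuous_subtype_val.continuousAt.eventually_lt_const hxb)
    filter_upwards [hb, self_mem_nhdsWithin] with y hy1 hy2
    have h1 := hk y hy2 hy1
    have h2 : (0 : ℝ) ≤ (n : ℝ) ^ k * ((y : ℝ) - x) :=
      mul_nonneg (zpow_pos (base_pos (n := n)) k).le (sub_nonneg.2 hy2)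
    change (h x : ℝ) ≤ h y
    linarith
  exact (hg (h x)).tendsto.comp ht

theorem rightCont_symm {n r : ℕ} [NeZero n] {e : Equiv.Perm (Ico (0 : ℝ) r)}
    (hc : ∀ x, ContinuousWithinAt e (Ici x) x) (hP : IsPiecewiseLinear n e) (y : Ico (0 : ℝ) r) :
    ContinuousWithinAt e.symm (Ici y) y := by
  obtain ⟨x, rfl⟩ := e.surjective y
  obtain ⟨b, hxb, hbr, k, hk⟩ := right_piece hc hP x
  have hpos := zpow_pos (base_pos (n := n)) k
  have hcont : Continuous fun w : Ico (0 : ℝ) r =>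
      (x : ℝ) + ((n : ℝ) ^ k)⁻¹ * ((w : ℝ) - e x) := by fun_prop
  have hlt : ∀ᶠ w : Ico (0 : ℝ) r in 𝓝[Ici (e x)] (e x),
      (x : ℝ) + ((n : ℝ) ^ k)⁻¹ * ((w : ℝ) - e x) < b :=
    nhdsWithin_le_nhds (hcont.continuousAt.eventually_lt_const (by simpa using hxb))
  have heq : ∀ᶠ w : Ico (0 : ℝ) r in 𝓝[Ici (e x)] (e x),
      (e.symm w : ℝ) = (x : ℝ) + ((n : ℝ) ^ k)⁻¹ * ((w : ℝ) - e x) := by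
    filter_upwards [hlt, self_mem_nhdsWithin] with w hw1 hw2
    have hw2' : (e x : ℝ) ≤ w := hw2
    have h0 : 0 ≤ ((n : ℝ) ^ k)⁻¹ * ((w : ℝ) - e x) :=
      mul_nonneg (inv_pos.2 hpos).le (sub_nonneg.2 hw2')
    have hxz : (x : ℝ) ≤ (x : ℝ) + ((n : ℝ) ^ k)⁻¹ * ((w : ℝ) - e x) := by linarith
    let z : Ico (0 : ℝ) r := ⟨_, x.2.1.trans hxz, hw1.trans_le hbr⟩
    have hz : e z = w := by
      apply Subtype.ext
      rw [hk z hxz hw1]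
      simp only [z]
      field_simp
      ring
    rw [← hz, Equiv.symm_apply_apply, hz]
  have hval : ContinuousWithinAt (fun w => (e.symm w : ℝ)) (Ici (e x)) (e x) :=
    hcont.continuousWithinAt.congr_of_eventuallyEq heq (by simp)
  exact tendsto_subtype_rng.2 hval

variable (n r : ℕ) [NeZero n] [NeZero r]

theorem r_pos {r : ℕ} [NeZero r] : (0 : ℝ) < r := by exact_mod_cast Nat.pos_of_ne_zero (NeZero.ne r)

/-- The Higman–Thompson group `G_{n,r}`: right continuous piecewise linear bijections of `[0,r)`
with finitely many discontinuities and singularities, all in `ℤ[1/n]`, with all slopes integral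
powers of `n`, which map `ℤ[1/n] ∩ [0,r)` to itself. The group law is composition. -/
def groupG : Subgroup (Equiv.Perm (Ico (0 : ℝ) r)) where
  carrier := {h | (∀ x, ContinuousWithinAt h (Ici x) x) ∧ IsPiecewiseLinear n h ∧
    ∀ x : Ico (0 : ℝ) r, (x : ℝ) ∈ nAdic n → (h x : ℝ) ∈ nAdic n}
  one_mem' := ⟨fun x => continuousWithinAt_id, IsPiecewiseLinear.id, fun x hx => hx⟩
  mul_mem' := by
    rintro g h ⟨hg, hg', hg''⟩ ⟨hh, hh', hh''⟩
    exact ⟨rightCont_comp (g := g) (h := h) hg hh hh', hg'.comp hh' h.injective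
      (mem_nAdic_of_apply ordConnected_Ico (⟨0, le_rfl, r_pos⟩ : Ico (0 : ℝ) r) rfl (fun x => x.2.1) hh' hh hh''),
      fun x hx => hg'' _ (hh'' x hx)⟩
  inv_mem' := by
    rintro h ⟨hh, hh', hh''⟩
    refine ⟨rightCont_symm hh hh', ?_, ?_⟩
    · refine IsPiecewiseLinear.symm hh' (⟨0, le_rfl, r_pos⟩ : Ico (0 : ℝ) r) rfl hh'' fun x hx hA =>
        affineNear_symm_of_interior (Ico_mem_nhds ?_ x.2.2) hA
      exact lt_of_le_of_ne x.2.1 fun hcon => hx (Subtype.ext hcon.symm)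
    · intro x hx
      refine mem_nAdic_of_apply ordConnected_Ico (⟨0, le_rfl, r_pos⟩ : Ico (0 : ℝ) r) rfl (fun x => x.2.1) hh' hh
        hh'' _ ?_
      change ((h (h.symm x) : Ico (0 : ℝ) r) : ℝ) ∈ nAdic n
      rwa [Equiv.apply_symm_apply]

open Classical in
/-- Extension of a self-map of `[0,r)` to `[0,r]` which fixes the point `r`. -/
def extendG {r : ℕ} (h : Ico (0 : ℝ) r → Ico (0 : ℝ) r) (x : Icc (0 : ℝ) r) : Icc (0 : ℝ) r :=
  if hx : (x : ℝ) < r then ⟨h ⟨x, x.2.1, hx⟩, Ico_subset_Icc_self (h ⟨x, x.2.1, hx⟩).2⟩ else x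

theorem extendG_comp {r : ℕ} (g h : Ico (0 : ℝ) r → Ico (0 : ℝ) r) (x : Icc (0 : ℝ) r) :
    extendG (g ∘ h) x = extendG g (extendG h x) := by
  by_cases hx : (x : ℝ) < r
  · have := (h ⟨x, x.2.1, hx⟩).2.2
    simp [extendG, hx, this]
  · simp [extendG, hx]

/-- The canonical action of `G_{n,r}` on `[0,r]`: the endpoint `r` is fixed. -/
instance : MulAction (groupG n r) (Icc (0 : ℝ) r) where
  smul g x := extendG g.1 x
  one_smul x := by
    change extendG _root_.id x = x
    simp [extendG]
  mul_smul g h x := extendG_comp g.1 h.1 x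

end GroupG

section Measure

/-- The Lebesgue probability measure `λ_r` on `[0,r]`. -/
def lebesgueProb (r : ℕ) : Measure (Icc (0 : ℝ) r) := (r : ℝ≥0∞)⁻¹ • (volume : Measure ℝ).comap (fun x : Icc (0 : ℝ) r => (x : ℝ))

instance (r : ℕ) [NeZero r] : IsProbabilityMeasure (lebesgueProb r) where
  measure_univ := by
    rw [lebesgueProb, Measure.smul_apply, comap_subtype_coe_apply measurableSet_Icc]
    rw [image_univ, Subtype.range_coe, Real.volume_Icc, sub_zero, ENNReal.ofReal_natCast,
      smul_eq_mul, ENNReal.inv_mul_cancel (by simp [NeZero.ne r]) (by simp)]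

theorem quasi_of_affineNear {n r : ℕ} [NeZero n] {h : Icc (0 : ℝ) r → Icc (0 : ℝ) r}
    (hfin : {x | ¬ IsAffineNear n h x}.Finite) :
    Measure.QuasiMeasurePreserving h (lebesgueProb r) (lebesgueProb r) := by
  have hmeas : Measurable h := by
    refine measurable_of_isOpen fun U hU => ?_
    have : h ⁻¹' U = (h ⁻¹' U ∩ {x | ¬ IsAffineNear n h x}) ∪
        (h ⁻¹' U ∩ {x | ¬ IsAffineNear n h x}ᶜ) := (inter_union_compl _ _).symm
    rw [this]
    refine (hfin.subset inter_subset_right).measurableSet.union (IsOpen.measurableSet ?_)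
    rw [isOpen_iff_mem_nhds]
    rintro x ⟨hx1, hx2⟩
    refine inter_mem ?_ (hfin.isClosed.isOpen_compl.mem_nhds hx2)
    exact (IsAffineNear.continuousAt (not_not.1 hx2)).preimage_mem_nhds (hU.mem_nhds hx1)
  refine Measure.QuasiMeasurePreserving.smul_measure ⟨hmeas, ?_⟩ _
  refine Measure.AbsolutelyContinuous.mk fun N hN hN0 => ?_
  rw [Measure.map_apply hmeas hN]
  have hfin0 : ((volume : Measure ℝ).comap (fun x : Icc (0 : ℝ) r => (x : ℝ))) {x | ¬ IsAffineNear n h x} = 0 := by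
    rw [comap_subtype_coe_apply measurableSet_Icc]
    exact (hfin.image _).measure_zero _
  have hmain : ((volume : Measure ℝ).comap (fun x : Icc (0 : ℝ) r => (x : ℝ))) (h ⁻¹' N \ {x | ¬ IsAffineNear n h x}) = 0 := by
    refine measure_null_of_locally_null _ fun x hx => ?_
    obtain ⟨k, c, hk⟩ := not_not.1 hx.2
    refine ⟨{y | (h y : ℝ) = (n : ℝ) ^ k * (y : ℝ) + c} ∩ (h ⁻¹' N \ {x | ¬ IsAffineNear n h x}),
      inter_mem (nhdsWithin_le_nhds hk) self_mem_nhdsWithin, ?_⟩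
    rw [comap_subtype_coe_apply measurableSet_Icc] at hN0 ⊢
    have hpos := (zpow_pos (base_pos (n := n)) k).ne'
    have h1 : volume ((fun y : ℝ => (n : ℝ) ^ k * y) ⁻¹'
        ((fun z : ℝ => z + c) ⁻¹' ((fun z : Icc (0 : ℝ) r => (z : ℝ)) '' N))) = 0 := by
      rw [Real.volume_preimage_mul_left hpos, measure_preimage_add_right, hN0, mul_zero]
    refine measure_mono_null ?_ h1
    rintro _ ⟨y, ⟨hy1, hy2, -⟩, rfl⟩
    exact ⟨h y, hy2, hy1⟩
  exact measure_mono_null (fun x hx => by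
    by_cases hA : IsAffineNear n h x
    · exact Or.inr ⟨hx, not_not.2 hA⟩
    · exact Or.inl hA) (measure_union_null hfin0 hmain)

instance (n r : ℕ) [NeZero n] :
    Koopman.MeasureClassPreserving (groupF n r) (lebesgueProb r) where
  quasi g := quasi_of_affineNear g.2.2.finite

instance (n r : ℕ) [NeZero n] [NeZero r] :
    Koopman.MeasureClassPreserving (groupG n r) (lebesgueProb r) where
  quasi g := by
    refine quasi_of_affineNear (n := n) (h := extendG g.1) ?_
    refine ((g.2.2.1.finite.image fun z : Ico (0 : ℝ) r => (⟨z, Ico_subset_Icc_self z.2⟩ : Icc (0 : ℝ) r)).union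
      (finite_singleton (⟨r, by simp⟩ : Icc (0 : ℝ) r))).subset fun x hx => ?_
    by_cases hxr : (x : ℝ) < r
    · refine Or.inl ⟨⟨x, x.2.1, hxr⟩, fun hA => hx ?_, rfl⟩
      obtain ⟨k, c, hk⟩ := hA
      refine ⟨k, c, ?_⟩
      rw [nhds_subtype, Filter.eventually_comap] at hk ⊢
      filter_upwards [hk, Iio_mem_nhds hxr] with b hb hbr
      rintro y rfl
      have hy : (y : ℝ) < r := hbr
      simpa [extendG, hy] using hb ⟨y, y.2.1, hy⟩ rfl
    · exact Or.inr (Subtype.ext (le_antisymm x.2.2 (not_lt.1 hxr)))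

end Measure

end HigmanThompson

end

/-! Let `V` be a closed invariant subspace. The idea is to show that `V` consists of the functions
supported on one invariant set, and that such a set is trivial.

Let `g` fix the complement of `(a, b)` and move every point of `(a, b)` to the left. If `κ(g) k =
k`, the finite measure `|k|² dλ` is `g`-invariant, so a bounded increasing function has the same
integral before and after composition with `g`; this forces `k = 0` on `(a, b)`
(`eq_zero_of_koopman_fixed`). Functions vanishing on `(a, b)` are fixed, since the density is `1`
where `g` is the identity. Hence the projection onto the vectors fixed by `κ(g)` is multiplication
by the indicator of the complement of `(a, b)`, and it preserves `V` (`mem_of_fixed_of_orthogonal`).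

For `f ∈ V` and `w ∈ Vᗮ` the pointwise inner product thus has integral zero over `(a, b)` for all
`n`-adic `a < b`, so it vanishes almost everywhere (`ae_inner_eq_zero`). Write `1 = u + v` with `u ∈
V`, `v ∈ Vᗮ`: then `u` takes only the values `0` and `1`, and is group invariant
(`comp_inv_smul_ae_eq`). The maps `shrink n 0 r t` are translations by `-(n - 1) t` on most of `[0,
r]`; letting `t` run through a dense set makes `u` constant (`ae_const_of_invariant`), so `V` or
`Vᗮ` is zero.

Only the maps `shrink` are used. They lie in `F_{n,r}`, whose action is realised inside `G_{n,r}`,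
so one argument serves both groups. -/

namespace Koopman

/-! ### Invariant subspaces of a unitary representation and fixed vectors of one element. -/

section Reducing

variable {G H : Type*} [Group G] [NormedAddCommGroup H] [InnerProductSpace ℂ H] [CompleteSpace H]
  {π : G →* unitary (H →L[ℂ] H)} {V : Submodule ℂ H}

theorem inner_rep_rep (g : G) (x y : H) :
    inner ℂ ((π g : H →L[ℂ] H) x) ((π g : H →L[ℂ] H) y) = inner ℂ x y := by
  rw [← ContinuousLinearMap.adjoint_inner_right, ← ContinuousLinearMap.star_eq_adjoint,
    ← mul_apply_eq_comp, Unitary.coe_star_mul_self, one_apply_eq_self]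

theorem rep_mul_apply (g h : G) (x : H) :
    (π (g * h) : H →L[ℂ] H) x = (π g : H →L[ℂ] H) ((π h : H →L[ℂ] H) x) := by
  simp

/-- The adjoint of `π g` is `π g⁻¹`, which also preserves `V`. -/
theorem orthogonal_invariant (hV : ∀ g : G, ∀ v ∈ V, (π g : H →L[ℂ] H) v ∈ V) (g : G) {w : H}
    (hw : w ∈ Vᗮ) : (π g : H →L[ℂ] H) w ∈ Vᗮ := by
  rw [Submodule.mem_orthogonal] at hw ⊢
  intro u hu
  have h := hw _ (hV g⁻¹ u hu)
  rw [← inner_rep_rep (π := π) g, ← rep_mul_apply] at h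
  simpa using h

/-- An invariant closed subspace is stable under the orthogonal projection onto the vectors fixed
by one element of the group. -/
theorem mem_of_fixed_of_orthogonal [V.HasOrthogonalProjection]
    (hV : ∀ g : G, ∀ v ∈ V, (π g : H →L[ℂ] H) v ∈ V) (g : G) {f q : H} (hf : f ∈ V)
    (hq : (π g : H →L[ℂ] H) q = q)
    (hfq : ∀ k, (π g : H →L[ℂ] H) k = k → inner ℂ k (f - q) = (0 : ℂ)) : q ∈ V := by
  obtain ⟨v, hv, w, hw, rfl⟩ := V.exists_add_mem_mem_orthogonal q
  -- As `q = v + w` is fixed, `π g w - w` is the negative of `π g v - v`; it lies in both `V` and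
  -- `Vᗮ`.
  have hwfix : (π g : H →L[ℂ] H) w = w := by
    have h1 : (π g : H →L[ℂ] H) v - v = -((π g : H →L[ℂ] H) w - w) := by
      rw [map_add] at hq
      rw [neg_sub, sub_eq_sub_iff_add_eq_add, hq, add_comm]
    have h2 : (π g : H →L[ℂ] H) w - w ∈ V := by
      rw [← neg_mem_iff, ← h1]
      exact V.sub_mem (hV g v hv) hv
    have h3 : (π g : H →L[ℂ] H) w - w ∈ Vᗮ := Vᗮ.sub_mem (orthogonal_invariant hV g hw) hw
    exact sub_eq_zero.1 (inner_self_eq_zero.1 (Submodule.inner_right_of_mem_orthogonal h2 h3))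
  -- Since `w` is orthogonal to both `f` and `v`, this reduces to `‖w‖² = 0`.
  have h4 := hfq w hwfix
  rw [inner_sub_right, inner_add_right, Submodule.inner_left_of_mem_orthogonal hf hw,
    Submodule.inner_left_of_mem_orthogonal hv hw, zero_add, zero_sub, neg_eq_zero,
    inner_self_eq_zero] at h4
  simpa [h4] using hv

end Reducing

/-! ### Fixed vectors of Koopman operators and functions with disjoint supports. -/

section Rep

variable {G X : Type*} [Group G] [MulAction G X] [MeasurableSpace X]
  (μ : Measure X) [IsProbabilityMeasure μ] [MeasureClassPreserving G μ]

/-- By the cocycle identity for `g * g⁻¹ = 1`, the density is a factor of `1`. -/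
theorem density_ne_zero (g : G) : ∀ᵐ x ∂μ, density μ g x ≠ 0 := by
  filter_upwards [density_mul μ g g⁻¹, density_one (G := G) μ] with x h1 h2 h3
  rw [mul_inv_cancel, h2, h3, zero_mul] at h1
  exact one_ne_zero h1

/-- On subsets of the fixed-point set, `μ` and its push-forward under `g` coincide. -/
theorem density_eq_one_of_fixed (g : G) (hT : MeasurableSet {x : X | g • x = x}) :
    ∀ᵐ x ∂μ, g • x = x → density μ g x = 1 := by
  set T := {x : X | g • x = x}
  have hsmul := measurable_smul μ g
  have hres : (μ.map (fun x : X => g • x)).restrict T = μ.restrict T := by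
    ext A hA
    rw [Measure.restrict_apply hA, Measure.restrict_apply hA, Measure.map_apply hsmul (hA.inter hT)]
    congr 1
    ext x
    constructor
    · rintro ⟨h1, h2⟩
      have h3 : g • x = x := smul_left_cancel g h2
      change g • x ∈ A at h1
      rw [h3] at h1
      exact ⟨h1, h3⟩
    · rintro ⟨h1, h2⟩
      have h2' : g • x = x := h2
      change g • x ∈ A ∩ T
      rw [h2']
      exact ⟨h1, h2⟩
  have : IsFiniteMeasure (μ.map (fun x : X => g • x)) := Measure.isFiniteMeasure_map _ _
  have h1 := Measure.rnDeriv_restrict (μ.map (fun x : X => g • x)) μ hT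
  rw [hres] at h1
  filter_upwards [h1, Measure.rnDeriv_restrict_self μ hT] with x h2 h3 hx
  have hxT : x ∈ T := hx
  rw [h3, indicator_of_mem hxT, indicator_of_mem hxT] at h2
  exact h2.symm

/-- A vector fixed by `κ(g)` defines a finite `g`-invariant measure, so it vanishes on the set of
points at which a bounded function is strictly decreased by `g`. -/
theorem eq_zero_of_koopman_fixed (g : G) {p : X → ℝ≥0∞} (hp : Measurable p) {C : ℝ≥0}
    (hC : ∀ x, p x ≤ C) (hle : ∀ x, p (g • x) ≤ p x) {k : Lp ℂ 2 μ}
    (hk : (koopman G μ g : Lp ℂ 2 μ →L[ℂ] Lp ℂ 2 μ) k = k) :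
    ∀ᵐ x ∂μ, p (g • x) < p x → k x = 0 := by
  have hkm : Measurable k := (Lp.stronglyMeasurable k).measurable
  have hF : Measurable fun x => ‖k x‖ₑ ^ (2 : ℝ) := by fun_prop
  have hpg : Measurable fun x => p (g • x) := hp.comp (measurable_smul μ g)
  have hinv : ∀ᵐ x ∂μ, ‖k x‖ₑ ^ (2 : ℝ) = density μ g x * ‖k (g⁻¹ • x)‖ₑ ^ (2 : ℝ) := by
    have h1 := koopman_apply μ g k
    rw [hk] at h1
    filter_upwards [h1, density_lt_top μ g] with x hx hlt
    rw [hx, koopmanFun, enorm_mul, ENNReal.mul_rpow_of_nonneg _ _ (by norm_num)]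
    congr 1
    rw [← ofReal_norm, Complex.norm_real, Real.norm_of_nonneg (Real.sqrt_nonneg _),
      ENNReal.ofReal_rpow_of_nonneg (Real.sqrt_nonneg _) (by norm_num), Real.rpow_ofNat,
      Real.sq_sqrt ENNReal.toReal_nonneg, ENNReal.ofReal_toReal hlt.ne]
  have hfin : ∫⁻ x, ‖k x‖ₑ ^ (2 : ℝ) ∂μ ≠ ∞ := by
    have h := lintegral_rpow_enorm_lt_top_of_eLpNorm_lt_top (by simp) (by simp) (Lp.memLp k).2
    simpa using h.ne
  -- Invariance of the measure `|k|² dμ`, tested on `p`.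
  have hint : ∫⁻ x, p x * ‖k x‖ₑ ^ (2 : ℝ) ∂μ = ∫⁻ x, p (g • x) * ‖k x‖ₑ ^ (2 : ℝ) ∂μ := by
    rw [← lintegral_density_mul μ g (F := fun x => p (g • x) * ‖k x‖ₑ ^ (2 : ℝ)) (hpg.mul hF)]
    refine lintegral_congr_ae ?_
    filter_upwards [hinv] with x hx
    rw [hx, smul_inv_smul, mul_left_comm]
  have hfin' : ∫⁻ x, p (g • x) * ‖k x‖ₑ ^ (2 : ℝ) ∂μ ≠ ∞ := by
    refine ne_top_of_le_ne_top (ENNReal.mul_ne_top (ENNReal.coe_ne_top (r := C)) hfin) ?_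
    rw [← lintegral_const_mul _ hF]
    exact lintegral_mono fun x => mul_le_mul_left (hC _) _
  -- One integrand dominates the other and the integrals are equal and finite (this is where the
  -- bound `C` enters), so the integrands agree almost everywhere.
  have hae := ae_eq_of_ae_le_of_lintegral_le
    (Eventually.of_forall fun x => mul_le_mul_left (hle x) (‖k x‖ₑ ^ (2 : ℝ))) hfin'
    (hp.mul hF).aemeasurable hint.le
  filter_upwards [hae] with x hx hlt
  by_contra hne
  refine hlt.ne ((ENNReal.mul_left_inj ?_ ?_).1 hx)
  · simpa using hne
  · simp

variable {μ} {V : Submodule ℂ (Lp ℂ 2 μ)}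

/-- The function `p` is a Lyapunov function for `g`. It forces fixed vectors to vanish off the
fixed-point set `T`, so the truncation of `f` to `T` is its projection onto the fixed vectors and
stays in `V`. Both `f` and the truncation are then orthogonal to `w`; subtracting leaves the
integral over the moved points. -/
theorem setIntegral_inner_eq_zero (hcl : IsClosed (V : Set (Lp ℂ 2 μ)))
    (hV : ∀ g : G, ∀ v ∈ V, (koopman G μ g : Lp ℂ 2 μ →L[ℂ] Lp ℂ 2 μ) v ∈ V) (g : G)
    {p : X → ℝ≥0∞} (hp : Measurable p) {C : ℝ≥0}
    (hC : ∀ x, p x ≤ C) (hle : ∀ x, p (g • x) ≤ p x) (hlt : ∀ x, g • x ≠ x → p (g • x) < p x)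
    {f w : Lp ℂ 2 μ} (hf : f ∈ V) (hw : w ∈ Vᗮ) :
    ∫ x in {x | g • x ≠ x}, inner ℂ (f x) (w x) ∂μ = 0 := by
  have : CompleteSpace V := hcl.completeSpace_coe
  have hT : MeasurableSet {x : X | g • x = x} := by
    have : {x : X | g • x = x} = {x | p x ≤ p (g • x)} := by
      ext x
      refine ⟨fun h => ?_, fun h => by_contra fun hne => (hlt x hne).not_ge h⟩
      change p x ≤ p (g • x)
      rw [show g • x = x from h]
    rw [this]
    exact measurableSet_le hp (hp.comp (measurable_smul μ g))
  set T := {x : X | g • x = x} with hTdef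
  have hqm : MemLp (T.indicator f) 2 μ := (Lp.memLp f).indicator hT
  set q : Lp ℂ 2 μ := hqm.toLp _
  have hqae : q =ᵐ[μ] T.indicator f := MemLp.coeFn_toLp hqm
  have hqfix : (koopman G μ g : Lp ℂ 2 μ →L[ℂ] Lp ℂ 2 μ) q = q := by
    apply Lp.ext
    refine (koopman_apply μ g q).trans ((koopmanFun_congr μ g hqae).trans (.trans ?_ hqae.symm))
    filter_upwards [density_eq_one_of_fixed μ g hT] with x hx
    by_cases hxT : g • x = x
    · have : g⁻¹ • x = x := inv_smul_eq_iff.2 hxT.symm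
      simp [koopmanFun, hx hxT, this]
    · have h1 : x ∉ T := hxT
      have h2 : g⁻¹ • x ∉ T := fun h => hxT (by
        have h' : g • g⁻¹ • x = g⁻¹ • x := h
        rw [smul_inv_smul] at h'
        exact (inv_smul_eq_iff.1 h'.symm).symm)
      simp [koopmanFun, h1, h2]
  have hqV : q ∈ V := by
    refine mem_of_fixed_of_orthogonal hV g hf hqfix fun k hk => ?_
    rw [L2.inner_def]
    refine integral_eq_zero_of_ae ?_
    filter_upwards [eq_zero_of_koopman_fixed μ g hp hC hle hk, hqae, Lp.coeFn_sub f q] with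
      x h1 h2 h3
    rw [h3, Pi.sub_apply, h2]
    by_cases hxT : g • x = x
    · have : x ∈ T := hxT
      simp [this]
    · simp [h1 (hlt x hxT)]
  have h1 : inner ℂ f w = (0 : ℂ) := Submodule.inner_right_of_mem_orthogonal hf hw
  have h2 : inner ℂ q w = (0 : ℂ) := Submodule.inner_right_of_mem_orthogonal hqV hw
  have h3 : inner ℂ q w = ∫ x in T, inner ℂ (f x) (w x) ∂μ := by
    rw [L2.inner_def, ← integral_indicator hT]
    refine integral_congr_ae ?_
    filter_upwards [hqae] with x hx
    rw [hx]
    by_cases hxT : x ∈ T <;> simp [hxT]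
  have h4 := integral_add_compl hT (L2.integrable_inner (𝕜 := ℂ) f w)
  rw [← h3, h2, ← L2.inner_def, h1, zero_add] at h4
  exact h4

/-- If `V` and its orthogonal complement consist of functions with disjoint supports, then the
component in `V` of a constant function is an invariant function. -/
theorem comp_inv_smul_ae_eq
    (hV : ∀ g : G, ∀ v ∈ V, (koopman G μ g : Lp ℂ 2 μ →L[ℂ] Lp ℂ 2 μ) v ∈ V)
    (hort : ∀ f ∈ V, ∀ w ∈ Vᗮ, ∀ᵐ x ∂μ, inner ℂ (f x) (w x) = (0 : ℂ))
    {u v : Lp ℂ 2 μ} (hu : u ∈ V) (hv : v ∈ Vᗮ) (huv : ∀ᵐ x ∂μ, u x + v x = 1) (g : G) :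
    ∀ᵐ x ∂μ, u (g⁻¹ • x) = u x := by
  have hqm := MeasureClassPreserving.quasi (G := G) (μ := μ) g⁻¹
  -- With `v = 1 - u`, the three orthogonality relations say that almost everywhere `u x` is `0` or
  -- `1`, that `u (g⁻¹ • x) = 0` if `u x = 0`, and that `u (g⁻¹ • x) = 1` if `u x = 1`.
  filter_upwards [hort u hu v hv, hort _ (hV g u hu) v hv,
    hort u hu _ (orthogonal_invariant hV g hv), koopman_apply μ g u, koopman_apply μ g v, huv,
    hqm.ae huv, density_ne_zero μ g, density_lt_top μ g] with x h1 h2 h3 h4 h5 h6 h7 h8 h9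
  have hs : ((Real.sqrt (density μ g x).toReal : ℝ) : ℂ) ≠ 0 := by
    have := Real.sqrt_pos.2 (ENNReal.toReal_pos h8 h9.ne)
    exact_mod_cast this.ne'
  rw [h4, koopmanFun] at h2
  rw [h5, koopmanFun] at h3
  rw [eq_sub_of_add_eq' h7] at h3
  rw [eq_sub_of_add_eq' h6] at h1 h2
  simp only [RCLike.inner_apply, mul_eq_zero, map_mul, map_eq_zero, hs, false_or] at h1 h2 h3
  by_cases hp : u x = 0
  · rw [hp] at h2 ⊢
    simpa using h2
  · have h1' := (sub_eq_zero.1 (h1.resolve_right hp)).symm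
    have h3' := (sub_eq_zero.1 (h3.resolve_right hp)).symm
    rw [h1', h3']

end Rep

end Koopman

/-! ### A piecewise linear map pushing an interval to the left. -/

namespace HigmanThompson

/-- The map of slopes `1, 1/n, 1, n, 1` with breaks at `a, a + n t, b - t, b`, which fixes the
complement of `(a, b)` and moves every point of `(a, b)` to the left. -/
noncomputable def shrink (n : ℕ) (a b t x : ℝ) : ℝ :=
  min x (max (a + (x - a) / n) (max (x - (n - 1) * t) (b - n * (b - x))))

section Shrink

variable {n : ℕ} {a b t x : ℝ}

theorem shrink_le : shrink n a b t x ≤ x := min_le_left _ _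

theorem continuous_shrink : Continuous (shrink n a b t) := by
  unfold shrink
  fun_prop

/-- Minima and maxima of increasing affine functions are increasing; this is the benefit of the
lattice formula over a definition by cases. -/
theorem strictMono_shrink (hn : 0 < n) : StrictMono (shrink n a b t) := by
  intro x y hxy
  have hn' : (0 : ℝ) < n := by exact_mod_cast hn
  have h1 : (x - a) / n < (y - a) / n := by gcongr
  have h2 : (n : ℝ) * (b - y) < n * (b - x) := by gcongr
  refine min_lt_min hxy (max_lt_max (by linarith) (max_lt_max (by linarith) (by linarith)))

theorem div_sub_eq (hn : 0 < n) (x a : ℝ) : (n : ℝ) * ((x - a) / n) = x - a :=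
  mul_div_cancel₀ _ (by positivity)

theorem shrink_of_le_left (hn : 2 ≤ n) (hx : x ≤ a) : shrink n a b t x = x := by
  have hn' : (2 : ℝ) ≤ n := by exact_mod_cast hn
  refine min_eq_left (le_max_of_le_left ?_)
  have := div_sub_eq (by omega : 0 < n) x a
  nlinarith

theorem shrink_of_right_le (hn : 2 ≤ n) (hx : b ≤ x) : shrink n a b t x = x := by
  have hn' : (2 : ℝ) ≤ n := by exact_mod_cast hn
  refine min_eq_left (le_max_of_le_right (le_max_of_le_right ?_))
  nlinarith

theorem shrink_lt (hn : 2 ≤ n) (ht : 0 < t) (hax : a < x) (hxb : x < b) :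
    shrink n a b t x < x := by
  have hn' : (2 : ℝ) ≤ n := by exact_mod_cast hn
  have := div_sub_eq (by omega : 0 < n) x a
  refine min_lt_of_right_lt (max_lt ?_ (max_lt ?_ ?_)) <;> nlinarith

theorem shrink_ne_iff (hn : 2 ≤ n) (ht : 0 < t) : shrink n a b t x ≠ x ↔ x ∈ Ioo a b := by
  constructor
  · intro h
    by_contra hx
    rw [mem_Ioo, not_and_or, not_lt, not_lt] at hx
    exact h (hx.elim (shrink_of_le_left hn) (shrink_of_right_le hn))
  · exact fun h => (shrink_lt hn ht h.1 h.2).ne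

/-- The lines of slopes `1/n` and `1` cross at `a + n t`, those of slopes `1` and `n` at `b - t`.
The condition `(n + 1) t ≤ b - a` puts these crossings in the right order, so the maximum follows
the three lines in turn. -/
theorem shrink_of_mem_left (hn : 2 ≤ n) (hab : (n + 1) * t ≤ b - a) (hax : a ≤ x)
    (hx : x ≤ a + n * t) : shrink n a b t x = a + (x - a) / n := by
  have hn' : (2 : ℝ) ≤ n := by exact_mod_cast hn
  have := div_sub_eq (by omega : 0 < n) x a
  set z := (x - a) / n
  have hz0 : 0 ≤ z := by nlinarith
  have hzt : z ≤ t := by nlinarith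
  rw [shrink, max_eq_left, min_eq_right]
  · nlinarith
  · refine max_le ?_ ?_
    · nlinarith
    · nlinarith

theorem shrink_of_mem_middle (hn : 2 ≤ n) (ht : 0 < t) (hax : a + n * t ≤ x) (hxb : x ≤ b - t) :
    shrink n a b t x = x - (n - 1) * t := by
  have hn' : (2 : ℝ) ≤ n := by exact_mod_cast hn
  have := div_sub_eq (by omega : 0 < n) x a
  set z := (x - a) / n
  have hzt : t ≤ z := by nlinarith
  rw [shrink, max_eq_right, max_eq_left, min_eq_right]
  · nlinarith
  · nlinarith
  · exact le_max_of_le_left (by nlinarith)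

theorem shrink_of_mem_right (hn : 2 ≤ n) (hab : (n + 1) * t ≤ b - a)
    (hbx : b - t ≤ x) (hx : x ≤ b) : shrink n a b t x = b - n * (b - x) := by
  have hn' : (2 : ℝ) ≤ n := by exact_mod_cast hn
  have := div_sub_eq (by omega : 0 < n) x a
  set z := (x - a) / n
  have hzt : t ≤ z := by nlinarith
  rw [shrink, max_eq_right, max_eq_right, min_eq_right]
  · nlinarith
  · nlinarith
  · exact le_max_of_le_left (by nlinarith)

theorem eventually_affine_shrink (hn : 2 ≤ n) (ht : 0 < t) (hab : (n + 1) * t ≤ b - a)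
    (hx : x ∉ ({a, a + n * t, b - t, b} : Set ℝ)) :
    ∃ (k : ℤ) (c : ℝ), ∀ᶠ y in 𝓝 x, shrink n a b t y = (n : ℝ) ^ k * y + c := by
  simp only [mem_insert_iff, mem_singleton_iff, not_or] at hx
  obtain ⟨h1, h2, h3, h4⟩ := hx
  rcases lt_or_gt_of_ne h1 with h | h
  · refine ⟨0, 0, ?_⟩
    filter_upwards [Iio_mem_nhds h] with y hy
    rw [shrink_of_le_left hn (le_of_lt hy)]; simp
  rcases lt_or_gt_of_ne h2 with h' | h'
  · refine ⟨-1, a - a / n, ?_⟩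
    filter_upwards [Ioo_mem_nhds h h'] with y hy
    rw [shrink_of_mem_left hn hab hy.1.le hy.2.le, zpow_neg_one]; ring
  rcases lt_or_gt_of_ne h3 with h'' | h''
  · refine ⟨0, -((n - 1) * t), ?_⟩
    filter_upwards [Ioo_mem_nhds h' h''] with y hy
    rw [shrink_of_mem_middle hn ht hy.1.le hy.2.le, zpow_zero]; ring
  rcases lt_or_gt_of_ne h4 with h5 | h5
  · refine ⟨1, b - n * b, ?_⟩
    filter_upwards [Ioo_mem_nhds h'' h5] with y hy
    rw [shrink_of_mem_right hn hab hy.1.le hy.2.le, zpow_one]; ring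
  · refine ⟨0, 0, ?_⟩
    filter_upwards [Ioi_mem_nhds h5] with y hy
    rw [shrink_of_right_le hn (le_of_lt hy)]; simp

end Shrink

/-! ### Realising these maps in the two groups. -/

section Elements

variable {n r : ℕ} [NeZero n]

theorem exists_groupF_shrink (hn : 2 ≤ n) {a b t : ℝ} (ha : a ∈ nAdic n) (hb : b ∈ nAdic n)
    (ht : t ∈ nAdic n) (ha0 : 0 ≤ a) (hbr : b ≤ r) (ht0 : 0 < t) (hab : (n + 1) * t ≤ b - a) :
    ∃ g : groupF n r, ∀ x : Icc (0 : ℝ) r, ((g • x : Icc (0 : ℝ) r) : ℝ) = shrink n a b t x := by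
  have hsm := strictMono_shrink (a := a) (b := b) (t := t) (by omega : 0 < n)
  have h0 : shrink n a b t 0 = 0 := shrink_of_le_left hn ha0
  have hr : shrink n a b t r = r := shrink_of_right_le hn hbr
  have hmaps : ∀ x : Icc (0 : ℝ) r, shrink n a b t x ∈ Icc (0 : ℝ) r := fun x =>
    ⟨h0.symm.trans_le (hsm.monotone x.2.1), (hsm.monotone x.2.2).trans_eq hr⟩
  let φ : Icc (0 : ℝ) r → Icc (0 : ℝ) r := fun x => ⟨shrink n a b t x, hmaps x⟩
  have hφ : StrictMono φ := fun x y hxy => hsm hxy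
  have hsurj : Function.Surjective φ := by
    intro y
    have hy : (y : ℝ) ∈ Icc (shrink n a b t 0) (shrink n a b t r) := by rw [h0, hr]; exact y.2
    obtain ⟨x, hx, hxy⟩ := intermediate_value_Icc (Nat.cast_nonneg r)
      continuous_shrink.continuousOn hy
    exact ⟨⟨x, hx⟩, Subtype.ext hxy⟩
  have hsing : ∀ x : Icc (0 : ℝ) r, ¬ IsAffineNear n φ x →
      (x : ℝ) ∈ ({a, a + n * t, b - t, b} : Set ℝ) := by
    intro x hx
    by_contra hcon
    obtain ⟨k, c, hk⟩ := eventually_affine_shrink hn ht0 hab hcon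
    exact hx ⟨k, c, continuous_subtype_val.continuousAt.eventually hk⟩
  -- An order isomorphism is a homeomorphism for the order topology, so continuity of the inverse is
  -- automatic.
  refine ⟨⟨(hφ.orderIsoOfSurjective φ hsurj).toHomeomorph, hφ, ?_, ?_⟩, fun x => rfl⟩
  · exact ((Set.toFinite ({a, a + n * t, b - t, b} : Set ℝ)).preimage
      Subtype.val_injective.injOn).subset hsing
  · intro x hx
    rcases hsing x hx with h | h | h | h <;> rw [h]
    · exact ha
    · exact add_mem_nAdic ha (by simpa using zpow_mul_mem_nAdic 1 ht)
    · exact sub_mem_nAdic hb ht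
    · exact hb

theorem lt_of_groupF {h : Icc (0 : ℝ) r ≃ₜ Icc (0 : ℝ) r} (hm : StrictMono h)
    {x : Icc (0 : ℝ) r} (hx : (x : ℝ) < r) : (h x : ℝ) < r :=
  (show (h x : ℝ) < h ⟨r, by simp⟩ from hm hx).trans_le (h ⟨r, by simp⟩).2.2

/-- Every element of `F_{n,r}` acts on `[0,r]` as some element of `G_{n,r}`. -/
theorem exists_groupG_of_groupF [NeZero r] (g : groupF n r) :
    ∃ γ : groupG n r, ∀ x : Icc (0 : ℝ) r, γ • x = g • x := by
  obtain ⟨h, hm, hP⟩ := g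
  have hm' : StrictMono h.symm := (inv_mem (show h ∈ groupF n r from ⟨hm, hP⟩)).1
  let e : Equiv.Perm (Ico (0 : ℝ) r) :=
    { toFun := fun x => ⟨h ⟨x, Ico_subset_Icc_self x.2⟩, (h _).2.1, lt_of_groupF hm x.2.2⟩
      invFun := fun x => ⟨h.symm ⟨x, Ico_subset_Icc_self x.2⟩, (h.symm _).2.1,
        lt_of_groupF hm' x.2.2⟩
      left_inv := fun x => by simp
      right_inv := fun x => by simp }
  have hinc : Continuous fun x : Ico (0 : ℝ) r => (⟨x, Ico_subset_Icc_self x.2⟩ : Icc (0 : ℝ) r) :=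
    by fun_prop
  have he : Continuous e :=
    ((continuous_subtype_val.comp h.continuous).comp hinc).subtype_mk _
  have hsing : ∀ x : Ico (0 : ℝ) r, ¬ IsAffineNear n e x →
      ¬ IsAffineNear n h ⟨x, Ico_subset_Icc_self x.2⟩ := by
    rintro x hx ⟨k, c, hk⟩
    exact hx ⟨k, c, hinc.continuousAt.eventually hk⟩
  refine ⟨⟨e, fun x => he.continuousWithinAt, ⟨?_, ?_⟩, ?_⟩, fun x => ?_⟩
  · exact (hP.finite.preimage (inclusion_injective Ico_subset_Icc_self).injOn).subset hsing
  · exact fun x hx => hP.mem_nAdic _ (hsing x hx)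
  · exact fun x hx => homeo_maps hm hP _ hx
  · change extendG e x = h x
    by_cases hx : (x : ℝ) < r
    · simp [extendG, hx, e]
    · have hxr : x = ⟨r, by simp⟩ := Subtype.ext (le_antisymm x.2.2 (not_lt.1 hx))
      -- An increasing homeomorphism fixes the endpoint `r`, which agrees with the convention in
      -- `extendG`.
      have htop : h ⟨r, by simp⟩ = ⟨r, by simp⟩ := by
        refine le_antisymm (h _).2.2 ?_
        have h1 : h.symm ⟨r, by simp⟩ ≤ ⟨r, by simp⟩ := (h.symm _).2.2
        simpa using hm.monotone h1
      rw [hxr, htop]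
      simp [extendG]

end Elements

/-! ### Density of the `n`-adic numbers. -/

section Density

theorem nAdic_dense {n : ℕ} (hn : 2 ≤ n) : Dense (nAdic n) := by
  have hn' : (1 : ℝ) < n := by exact_mod_cast hn
  refine dense_of_exists_between fun x y hxy => ?_
  obtain ⟨k, hk⟩ := pow_unbounded_of_one_lt (1 / (y - x)) hn'
  have hpos : (0 : ℝ) < (n : ℝ) ^ k := by positivity
  have hyx : 0 < y - x := sub_pos.2 hxy
  rw [div_lt_iff₀ hyx] at hk
  -- The first multiple of `n ^ (-k)` beyond `x`; it is below `y` because the mesh is smaller than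
  -- `y - x`.
  refine ⟨(⌊x * n ^ k⌋ + 1 : ℤ) / (n : ℝ) ^ k, ⟨_, _, rfl⟩, ?_, ?_⟩
  · rw [lt_div_iff₀ hpos]
    push_cast
    exact Int.lt_floor_add_one _
  · rw [div_lt_iff₀ hpos]
    push_cast
    have := Int.floor_le (x * (n : ℝ) ^ k)
    nlinarith

end Density

/-! ### Lebesgue differentiation: vanishing and constancy from a dense set of data. -/

section Primitive

variable {φ : ℝ → ℂ} {r : ℝ} {D : Set ℝ}

/-- The primitive from `0` is continuous and vanishes on a dense set, hence on the whole interval;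
its derivative is `φ` almost everywhere. -/
theorem ae_eq_zero_of_intervalIntegral_eq_zero (hφ : Integrable φ) (hD : Dense D) (h0 : 0 ∈ D)
    (h : ∀ a ∈ D, ∀ b ∈ D, 0 ≤ a → a < b → b ≤ r → ∫ x in a..b, φ x = 0) :
    ∀ᵐ x, x ∈ Ioo 0 r → φ x = 0 := by
  have hcont : Continuous fun x => ∫ y in (0 : ℝ)..x, φ y :=
    intervalIntegral.continuous_primitive (fun _ _ => hφ.intervalIntegrable) 0
  have hzero : ∀ x ∈ Ioo 0 r, ∫ y in (0 : ℝ)..x, φ y = 0 := by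
    have hcl : IsClosed {x | ∫ y in (0 : ℝ)..x, φ y = 0} := isClosed_eq hcont continuous_const
    intro x hx
    refine closure_minimal ?_ hcl (hD.open_subset_closure_inter isOpen_Ioo hx)
    rintro y ⟨hy1, hy2⟩
    exact h 0 h0 y hy2 le_rfl hy1.1 hy1.2.le
  filter_upwards [LocallyIntegrable.ae_hasDerivAt_integral hφ.locallyIntegrable] with x hx hxr
  refine (hx 0).unique ((hasDerivAt_const x (0 : ℂ)).congr_of_eventuallyEq ?_)
  filter_upwards [isOpen_Ioo.mem_nhds hxr] with y hy using hzero y hy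

/-- A function on an interval which is invariant under the translations by `c t`, for a dense set
of `t`, wherever they are defined with a margin proportional to `t`, is constant. -/
theorem ae_eq_const_of_translation (hr : 0 < r) (hφ : Integrable φ) (hD : Dense D) {c : ℝ}
    (hc : 0 < c)
    (h : ∀ t ∈ D, 0 < t → ∀ᵐ x, x ∈ Icc ((c + 1) * t) (r - t) → φ (x - c * t) = φ x) :
    ∃ C, ∀ᵐ x, x ∈ Ioo 0 r → φ x = C := by
  set Φ : ℝ → ℂ := fun x => ∫ y in (0 : ℝ)..x, φ y
  have hcont : Continuous Φ :=
    intervalIntegral.continuous_primitive (fun _ _ => hφ.intervalIntegrable) 0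
  have hsub : ∀ x y, Φ y - Φ x = ∫ z in x..y, φ z := fun x y =>
    intervalIntegral.integral_interval_sub_left hφ.intervalIntegrable hφ.intervalIntegrable
  have hder := LocallyIntegrable.ae_hasDerivAt_integral hφ.locallyIntegrable
  obtain ⟨x₀, hx₀D, hx₀⟩ := (Measure.dense_of_ae hder).exists_mem_open isOpen_Ioo
    (nonempty_Ioo.2 hr)
  have hshift : ∀ x y, 0 < x → x ≤ y → y < r → ∀ t, 0 < t → t < x → y + (c + 1) * t < r →
      Φ (y + c * t) - Φ (x + c * t) = Φ y - Φ x := by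
    intro x y hx hxy hy t ht htx hty
    -- For `s` in `O`, the shifted interval from `x + c s` to `y + c s` stays within the margins of
    -- `h`. As `O` is open, `D` is dense in it, and continuity of `Φ` extends the identity from `s ∈
    -- D` to all of `O`.
    let O : Set ℝ := Ioo 0 x ∩ {t | y + (c + 1) * t < r}
    have hO : IsOpen O := isOpen_Ioo.inter (isOpen_lt (by fun_prop) (by fun_prop))
    have hcl : IsClosed {t | Φ (y + c * t) - Φ (x + c * t) = Φ y - Φ x} :=
      isClosed_eq (by fun_prop) continuous_const
    refine closure_minimal ?_ hcl (hD.open_subset_closure_inter hO ⟨⟨ht, htx⟩, hty⟩)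
    rintro s ⟨⟨⟨hs0, hsx⟩, hsy⟩, hsD⟩
    have hsy' : y + (c + 1) * s < r := hsy
    change Φ (y + c * s) - Φ (x + c * s) = Φ y - Φ x
    have h1 : ∫ z in (x + c * s)..(y + c * s), φ z =
        ∫ z in (x + c * s)..(y + c * s), φ (z - c * s) := by
      refine intervalIntegral.integral_congr_ae ?_
      filter_upwards [h s hsD hs0] with z hz hzm
      rw [uIoc_of_le (by linarith)] at hzm
      refine (hz ⟨?_, ?_⟩).symm
      · nlinarith [hzm.1]
      · nlinarith [hzm.2]
    rw [hsub, hsub, h1, intervalIntegral.integral_comp_sub_right]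
    simp
  -- Small increments of `Φ` to the right of any two points agree, so differentiability at the
  -- single point `x₀` gives the right derivative `φ x₀` everywhere. Only right neighbourhoods
  -- appear since `t > 0`.
  have hshift' : ∀ x ∈ Ioo 0 r, ∀ y ∈ Ioo 0 r, ∀ᶠ z in 𝓝[≥] y,
      Φ z = Φ (x + (z - y)) - Φ x + Φ y := by
    have key : ∀ x ∈ Ioo 0 r, ∀ᶠ s in 𝓝 (0 : ℝ), s / c < x ∧ x + (c + 1) * (s / c) < r := by
      intro x hx
      have h1 : Continuous fun s : ℝ => s / c := by fun_prop
      have h2 : Continuous fun s : ℝ => x + (c + 1) * (s / c) := by fun_prop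
      exact ((h1.tendsto 0).eventually_lt_const (by simpa using hx.1)).and
        ((h2.tendsto 0).eventually_lt_const (by simpa using hx.2))
    intro x hx y hy
    have ht : Tendsto (fun z => z - y) (𝓝[≥] y) (𝓝 0) := by
      have : Tendsto (fun z => z - y) (𝓝 y) (𝓝 (y - y)) := by
        exact (continuous_id.sub continuous_const).tendsto y
      rw [sub_self] at this
      exact this.mono_left nhdsWithin_le_nhds
    filter_upwards [ht.eventually (key x hx), ht.eventually (key y hy), self_mem_nhdsWithin] with
      z hz1 hz2 hz3
    rcases (mem_Ici.1 hz3).eq_or_lt with rfl | hlt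
    · simp
    have hpos : 0 < (z - y) / c := div_pos (sub_pos.2 hlt) hc
    have hcs : c * ((z - y) / c) = z - y := mul_div_cancel₀ _ hc.ne'
    have e : y + c * ((z - y) / c) = z := by rw [hcs]; ring
    rcases le_total x y with hxy | hxy
    · have := hshift x y hx.1 hxy hy.2 _ hpos hz1.1 hz2.2
      rw [e, hcs] at this
      linear_combination this
    · have := hshift y x hy.1 hxy hx.2 _ hpos hz2.1 hz1.2
      rw [e, hcs] at this
      linear_combination -this
  have hright : ∀ y ∈ Ioo 0 r, HasDerivWithinAt Φ (φ x₀) (Ici y) y := by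
    intro y hy
    have h1 : HasDerivAt (fun z => Φ (x₀ + (z - y)) - Φ x₀ + Φ y) (φ x₀) y := by
      have h2 : HasDerivAt Φ (φ x₀) (x₀ - y + y) := by simpa using hx₀D 0
      have h3 := ((h2.comp_const_add (x₀ - y) y).sub_const (Φ x₀)).add_const (Φ y)
      refine h3.congr_of_eventuallyEq (Eventually.of_forall fun z => ?_)
      simp only
      rw [show x₀ + (z - y) = x₀ - y + z by ring]
    exact h1.hasDerivWithinAt.congr_of_eventuallyEq (hshift' x₀ hx₀ y hy) (by simp)
  -- A continuous function with zero right derivative is constant, so `Φ` is affine of slope `φ x₀`.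
  have haff : ∀ u ∈ Ioo 0 r, ∀ v ∈ Ioo 0 r, u ≤ v → Φ v - φ x₀ * v = Φ u - φ x₀ * u := by
    intro u hu v hv huv
    refine constant_of_has_deriv_right_zero (f := fun z : ℝ => Φ z - φ x₀ * z) (a := u) (b := v)
      (by fun_prop) (fun z hz => ?_) v ⟨huv, le_rfl⟩
    have h1 := hright z ⟨hu.1.trans_le hz.1, hz.2.trans hv.2⟩
    have h2 : HasDerivAt (fun z : ℝ => φ x₀ * (z : ℂ)) (φ x₀ * 1) z :=
      (Complex.ofRealCLM.hasDerivAt (x := z)).const_mul (φ x₀)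
    exact (h1.sub h2.hasDerivWithinAt).congr_deriv (by simp)
  refine ⟨φ x₀, ?_⟩
  filter_upwards [hder] with x hx hxr
  have h2 : HasDerivAt (fun z : ℝ => φ x₀ * (z : ℂ) + (Φ x - φ x₀ * x)) (φ x₀ * 1) x :=
    ((Complex.ofRealCLM.hasDerivAt (x := x)).const_mul (φ x₀)).add_const _
  rw [mul_one] at h2
  refine (hx 0).unique (h2.congr_of_eventuallyEq ?_)
  filter_upwards [isOpen_Ioo.mem_nhds hxr] with z hz
  change Φ z = _
  rcases le_total x z with hxz | hxz
  · linear_combination haff x hxr z hz hxz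
  · linear_combination -haff z hz x hxr hxz

end Primitive

/-! ### Passing between `λ_r` on `[0,r]` and Lebesgue measure on the line. -/

section Transfer

variable {r : ℕ}

theorem map_coe_lebesgueProb :
    (lebesgueProb r).map (fun x : Icc (0 : ℝ) r => (x : ℝ)) =
      (r : ℝ≥0∞)⁻¹ • volume.restrict (Icc (0 : ℝ) r) := by
  rw [lebesgueProb, Measure.map_smul, map_comap_subtype_coe measurableSet_Icc]

theorem ae_lebesgueProb_iff {P : ℝ → Prop} :
    (∀ᵐ x : Icc (0 : ℝ) r ∂lebesgueProb r, P x) ↔ ∀ᵐ x, x ∈ Icc (0 : ℝ) r → P x := by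
  rw [← ae_restrict_iff' measurableSet_Icc, ae_restrict_iff_subtype measurableSet_Icc, lebesgueProb,
    Measure.ae_ennreal_smul_measure_iff (by simp)]

theorem extend_coe (f : Icc (0 : ℝ) r → ℂ) (x : Icc (0 : ℝ) r) :
    Function.extend Subtype.val f 0 (x : ℝ) = f x :=
  Subtype.val_injective.extend_apply f 0 x

theorem ae_lebesgueProb_of_Ioo {P : Icc (0 : ℝ) r → Prop}
    (h : ∀ᵐ x : ℝ, x ∈ Ioo (0 : ℝ) r → ∀ hx : x ∈ Icc (0 : ℝ) r, P ⟨x, hx⟩) :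
    ∀ᵐ x ∂lebesgueProb r, P x := by
  have h1 : ∀ᵐ x : Icc (0 : ℝ) r ∂lebesgueProb r, ∀ hx : (x : ℝ) ∈ Icc (0 : ℝ) r, P ⟨x, hx⟩ := by
    refine (ae_lebesgueProb_iff (P := fun x => ∀ hx : x ∈ Icc (0 : ℝ) r, P ⟨x, hx⟩)).2 ?_
    filter_upwards [h, Measure.ae_ne volume 0, Measure.ae_ne volume (r : ℝ)] with x h1 h2 h3 h4
    exact h1 ⟨lt_of_le_of_ne h4.1 h2.symm, lt_of_le_of_ne h4.2 h3⟩
  filter_upwards [h1] with x hx using hx x.2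

variable [NeZero r]

theorem integrable_extend {f : Icc (0 : ℝ) r → ℂ} (hf : Integrable f (lebesgueProb r)) :
    Integrable (Function.extend Subtype.val f 0) := by
  have hsupp : Function.support (Function.extend Subtype.val f 0) ⊆ Icc (0 : ℝ) r := by
    intro x hx
    by_contra hcon
    refine hx (Function.extend_apply' _ _ _ ?_)
    rintro ⟨y, rfl⟩
    exact hcon y.2
  rw [← integrableOn_iff_integrable_of_support_subset hsupp, IntegrableOn,
    ← integrable_smul_measure (c := (r : ℝ≥0∞)⁻¹) (by simp) (by simp [NeZero.ne r]),
    ← map_coe_lebesgueProb,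
    (MeasurableEmbedding.subtype_coe measurableSet_Icc).integrable_map_iff]
  exact hf.congr (Eventually.of_forall fun x => (extend_coe f x).symm)

/-- The factor `r` undoes the normalization of `λ_r`; endpoints are null, so the open interval
suffices. -/
theorem intervalIntegral_extend (f : Icc (0 : ℝ) r → ℂ) {a b : ℝ} (ha : 0 ≤ a) (hab : a ≤ b)
    (hb : b ≤ r) :
    ∫ x in a..b, Function.extend Subtype.val f 0 x =
      r * ∫ x in {x : Icc (0 : ℝ) r | (x : ℝ) ∈ Ioo a b}, f x ∂lebesgueProb r := by
  have h1 := (MeasurableEmbedding.subtype_coe (measurableSet_Icc (a := (0 : ℝ)) (b := r))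
    ).setIntegral_map (μ := lebesgueProb r) (Function.extend Subtype.val f 0) (Ioo a b)
  rw [map_coe_lebesgueProb, Measure.restrict_smul, Measure.restrict_restrict measurableSet_Ioo,
    inter_eq_left.2 (Ioo_subset_Icc_self.trans (Icc_subset_Icc ha hb)), integral_smul_measure] at h1
  simp only [extend_coe] at h1
  change _ = r * ∫ x in Subtype.val ⁻¹' Ioo a b, f x ∂lebesgueProb r
  rw [← h1, intervalIntegral.integral_of_le hab, integral_Ioc_eq_integral_Ioo]
  have : (r : ℂ) ≠ 0 := by exact_mod_cast NeZero.ne r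
  simp [this]

end Transfer

/-! ### Ergodicity, disjointness of supports and irreducibility. -/

section Irreducible

variable {n r : ℕ} [NeZero n] [NeZero r] {Γ : Type*} [Group Γ] [MulAction Γ (Icc (0 : ℝ) r)]

/-- A group acting on `[0,r]` contains all the maps `shrink n a b t` of `[0,r]` with `n`-adic
breaks. -/
def ContainsShrinks (n : ℕ) {r : ℕ} (Γ : Type*) [Group Γ] [MulAction Γ (Icc (0 : ℝ) r)] : Prop :=
  ∀ a ∈ nAdic n, ∀ b ∈ nAdic n, ∀ t ∈ nAdic n, 0 ≤ a → b ≤ r → 0 < t → (n + 1) * t ≤ b - a →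
    ∃ γ : Γ, ∀ x : Icc (0 : ℝ) r, ((γ • x : Icc (0 : ℝ) r) : ℝ) = shrink n a b t x

/-- This is ergodicity. On its middle piece `[n t, r - t]`, the map `shrink n 0 r t` is the
translation by `-(n - 1) t`, so `ae_eq_const_of_translation` applies with `c = n - 1`. -/
theorem ae_const_of_invariant (hn : 2 ≤ n) (hΓ : ContainsShrinks n (r := r) Γ)
    {u : Icc (0 : ℝ) r → ℂ} (hu : Integrable u (lebesgueProb r))
    (hinv : ∀ γ : Γ, ∀ᵐ x ∂lebesgueProb r, u (γ • x) = u x) :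
    ∃ C, ∀ᵐ x ∂lebesgueProb r, u x = C := by
  have hn' : (2 : ℝ) ≤ n := by exact_mod_cast hn
  have htrans : ∀ t ∈ nAdic n, 0 < t → ∀ᵐ x, x ∈ Icc (((n : ℝ) - 1 + 1) * t) (r - t) →
      Function.extend Subtype.val u 0 (x - ((n : ℝ) - 1) * t) =
        Function.extend Subtype.val u 0 x := by
    intro t htD ht
    rw [sub_add_cancel]
    by_cases hle : (n + 1) * t ≤ r - 0
    · obtain ⟨γ, hγ⟩ := hΓ 0 zero_mem_nAdic r (natCast_mem_nAdic r) t htD le_rfl le_rfl ht hle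
      have h1 : ∀ᵐ x : Icc (0 : ℝ) r ∂lebesgueProb r,
          Function.extend Subtype.val u 0 (shrink n 0 r t x) =
          Function.extend Subtype.val u 0 (x : ℝ) := by
        filter_upwards [hinv γ] with x hx
        rw [← hγ, extend_coe, extend_coe, hx]
      rw [ae_lebesgueProb_iff (P := fun x => Function.extend Subtype.val u 0 (shrink n 0 r t x) =
          Function.extend Subtype.val u 0 x)] at h1
      filter_upwards [h1] with x hx hxm
      have h2 : (0 : ℝ) ≤ n * t := by positivity
      rw [← hx ⟨h2.trans hxm.1, by linarith [hxm.2]⟩,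
        shrink_of_mem_middle hn ht (by linarith [hxm.1]) hxm.2]
    -- For `(n + 1) t > r` the interval `[n t, r - t]` is empty.
    · refine Eventually.of_forall fun x hx => absurd (hx.1.trans hx.2) ?_
      linarith
  obtain ⟨C, hC⟩ := ae_eq_const_of_translation (c := (n : ℝ) - 1) (r_pos (r := r))
    (integrable_extend hu) (nAdic_dense hn) (by linarith) htrans
  refine ⟨C, ae_lebesgueProb_of_Ioo ?_⟩
  filter_upwards [hC] with x hx hxr hxI
  exact (extend_coe _ ⟨x, hxI⟩).symm.trans (hx hxr)

variable [Koopman.MeasureClassPreserving Γ (lebesgueProb r)]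
  {V : Submodule ℂ (Lp ℂ 2 (lebesgueProb r))}

theorem ae_inner_eq_zero (hn : 2 ≤ n) (hΓ : ContainsShrinks n (r := r) Γ)
    (hcl : IsClosed (V : Set (Lp ℂ 2 (lebesgueProb r))))
    (hV : ∀ g : Γ, ∀ v ∈ V, (Koopman.koopman Γ (lebesgueProb r) g :
      Lp ℂ 2 (lebesgueProb r) →L[ℂ] Lp ℂ 2 (lebesgueProb r)) v ∈ V)
    {f w : Lp ℂ 2 (lebesgueProb r)} (hf : f ∈ V) (hw : w ∈ Vᗮ) :
    ∀ᵐ x ∂lebesgueProb r, inner ℂ (f x) (w x) = (0 : ℂ) := by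
  have hn' : (2 : ℝ) ≤ n := by exact_mod_cast hn
  have hint : Integrable (fun x => inner ℂ (f x) (w x)) (lebesgueProb r) :=
    L2.integrable_inner f w
  have hzero := ae_eq_zero_of_intervalIntegral_eq_zero (r := r) (integrable_extend hint)
    (nAdic_dense hn) zero_mem_nAdic fun a ha b hb ha0 hab hbr => ?_
  · refine ae_lebesgueProb_of_Ioo ?_
    filter_upwards [hzero] with x hx hxr hxI
    exact (extend_coe _ ⟨x, hxI⟩).symm.trans (hx hxr)
  -- The choice `t = (b - a) / n²` is `n`-adic, and small enough because `n + 1 ≤ n²` for `n ≥ 2`.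
  · have ht0 : 0 < (n : ℝ) ^ (-2 : ℤ) * (b - a) := mul_pos (by positivity) (sub_pos.2 hab)
    have hle : (n + 1) * ((n : ℝ) ^ (-2 : ℤ) * (b - a)) ≤ b - a := by
      rw [← mul_assoc]
      refine mul_le_of_le_one_left (sub_pos.2 hab).le ?_
      rw [zpow_neg, ← div_eq_mul_inv, div_le_one (by positivity)]
      norm_cast
      nlinarith
    obtain ⟨γ, hγ⟩ := hΓ a ha b hb _ (zpow_mul_mem_nAdic (-2) (sub_mem_nAdic hb ha)) ha0 hbr ht0 hle
    have hmove : ∀ x : Icc (0 : ℝ) r, γ • x ≠ x ↔ (x : ℝ) ∈ Ioo a b := fun x => by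
      rw [← shrink_ne_iff hn ht0, ← hγ, Ne, Ne, Subtype.ext_iff]
    rw [intervalIntegral_extend _ ha0 hab.le hbr]
    simp_rw [← hmove]
    -- The coordinate serves as `p`: it is bounded by `r` and strictly decreased exactly on `(a,
    -- b)`.
    rw [Koopman.setIntegral_inner_eq_zero hcl hV γ
      (p := fun x : Icc (0 : ℝ) r => ENNReal.ofReal x) (by fun_prop) (C := r) ?_ ?_ ?_ hf hw,
      mul_zero]
    · intro x
      exact (ENNReal.ofReal_le_ofReal x.2.2).trans_eq (by simp)
    · intro x
      rw [hγ]
      exact ENNReal.ofReal_le_ofReal shrink_le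
    · intro x hx
      have hx' := (hmove x).1 hx
      rw [hγ]
      exact (ENNReal.ofReal_lt_ofReal_iff (ha0.trans_lt hx'.1)).2 (shrink_lt hn ht0 hx'.1 hx'.2)

theorem isIrreducibleRep_of_containsShrinks (hn : 2 ≤ n) (hΓ : ContainsShrinks n (r := r) Γ) :
    Koopman.IsIrreducibleRep (Koopman.koopman Γ (lebesgueProb r)) := by
  set μ := lebesgueProb r
  set e : Lp ℂ 2 μ := (memLp_const (1 : ℂ)).toLp _
  have he : e =ᵐ[μ] fun _ => 1 := MemLp.coeFn_toLp _
  refine ⟨⟨e, 0, fun h => ?_⟩, fun V hcl hV => ?_⟩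
  · rw [h] at he
    have h1 := (Lp.coeFn_zero ℂ 2 μ).symm.trans he
    obtain ⟨x, hx⟩ := h1.exists
    simp at hx
  have : CompleteSpace V := hcl.completeSpace_coe
  have hort : ∀ f ∈ V, ∀ w ∈ Vᗮ, ∀ᵐ x ∂μ, inner ℂ (f x) (w x) = (0 : ℂ) :=
    fun f hf w hw => ae_inner_eq_zero hn hΓ hcl hV hf hw
  obtain ⟨u, hu, v, hv, huv⟩ := V.exists_add_mem_mem_orthogonal e
  have huv' : ∀ᵐ x ∂μ, u x + v x = 1 := by
    filter_upwards [he, Lp.coeFn_add u v] with x h1 h2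
    rw [← h1, huv, h2, Pi.add_apply]
  obtain ⟨C, hC⟩ := ae_const_of_invariant hn hΓ ((Lp.memLp u).integrable one_le_two) fun γ => by
    simpa using Koopman.comp_inv_smul_ae_eq hV hort hu hv huv' γ⁻¹
  -- If `C = 0` then `v = 1` almost everywhere, and every `f ∈ V` is pointwise orthogonal to it.
  -- Otherwise `u` is a nonzero constant, and the same argument kills `Vᗮ`.
  by_cases hC0 : C = 0
  · left
    refine (Submodule.eq_bot_iff V).2 fun f hf => Lp.ext ?_
    filter_upwards [hort f hf v hv, huv', hC, Lp.coeFn_zero ℂ 2 μ] with x h1 h2 h3 h4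
    rw [h3, hC0, zero_add] at h2
    rw [h2] at h1
    rw [h4]
    simpa using h1
  · right
    rw [← Submodule.orthogonal_eq_bot_iff]
    refine (Submodule.eq_bot_iff Vᗮ).2 fun w hw => Lp.ext ?_
    filter_upwards [hort u hu w hw, hC, Lp.coeFn_zero ℂ 2 μ] with x h1 h3 h4
    rw [h3] at h1
    rw [h4]
    simpa [hC0] using h1

theorem containsShrinks_groupG (hn : 2 ≤ n) : ContainsShrinks n (r := r) (groupG n r) := by
  intro a ha b hb t ht ha0 hbr ht0 hab
  obtain ⟨g, hg⟩ := exists_groupF_shrink (r := r) hn ha hb ht ha0 hbr ht0 hab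
  obtain ⟨γ, hγ⟩ := exists_groupG_of_groupF g
  exact ⟨γ, fun x => by rw [hγ, hg]⟩

end Irreducible

theorem containsShrinks_groupF {n r : ℕ} [NeZero n] (hn : 2 ≤ n) : ContainsShrinks n (r := r) (groupF n r) :=
  fun _ ha _ hb _ ht ha0 hbr ht0 hab => exists_groupF_shrink hn ha hb ht ha0 hbr ht0 hab

end HigmanThompson

theorem theorem1 (n r : ℕ) [NeZero n] [NeZero r] (hn : 2 ≤ n) :
    Koopman.IsIrreducibleRep
      (Koopman.koopman (HigmanThompson.groupF n r) (HigmanThompson.lebesgueProb r)) ∧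
    Koopman.IsIrreducibleRep
      (Koopman.koopman (HigmanThompson.groupG n r) (HigmanThompson.lebesgueProb r)) :=
  ⟨HigmanThompson.isIrreducibleRep_of_containsShrinks hn
      (HigmanThompson.containsShrinks_groupF hn),
    HigmanThompson.isIrreducibleRep_of_containsShrinks hn
      (HigmanThompson.containsShrinks_groupG hn)⟩
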